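/- \textbf{Conventions.} Let $k$ be a field; all maps are $k$-linear, $\otimes=\otimes_k$, algebras are associative and unital, coalgebras coassociative and counital, and the name of a space also denotes its identity map. A \emph{braided Hopf algebra} is a vector space $H$ with an algebra structure $(\mu_H,1_H)$, a coalgebra structure $(\Delta,\epsilon)$ and a bijective solution $c\colon H\otimes H\to H\otimes H$ of the braid equation, compatible on both sides with $\mu_H,1_H,\Delta,\epsilon$, such that the unit is a coalgebra map, $\epsilon$ is an algebra map, $\Delta\circ\mu_H=(\mu_H\otimes\mu_H)\circ(H\otimes c\otimes H)\circ(\Delta\otimes\Delta)$, and $\mathrm{id}_H$ is convolution invertible. $H\otimes^cH$ is the coalgebra $H\otimes H$ with $\Delta_{H\otimes^cH}=(H\otimes c\otimes H)\circ(\Delta\otimes\Delta)$ and counit $\epsilon\otimes\epsilon$. A \emph{left transposition} of $H$ on an algebra $B$ is a bijection $s\colon H\otimes B\to B\otimes H$ compatible with the algebra and coalgebra structures of $H$, with the algebra structure of $B$, and with the braid: $(s\otimes H)(H\otimes s)(c\otimes B)=(B\otimes c)(s\otimes H)(H\otimes s)$. A \emph{right $H$-comodule algebra} $(B,s)$ is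 an algebra $B$ with a left transposition $s$ and a (coassociative, counital) coaction $\nu\colon B\to B\otimes H$ such that $(\nu\otimes H)s=(B\otimes c)(s\otimes H)(H\otimes\nu)$, $\nu\mu_B=(\mu_B\otimes\mu_H)(B\otimes s\otimes H)(\nu\otimes\nu)$ and $\nu(1_B)=1_B\otimes1_H$. Morphisms of right $H$-comodules $(V,s)\to(V',s')$ are the $H$-colinear maps $f$ with $(f\otimes H)s=s'(H\otimes f)$; morphisms of right $H$-comodule algebras are in addition algebra maps. An \emph{$H$-extension} $(i\colon A\hookrightarrow B,s)$ is such a $(B,s)$ together with an injective algebra map $i$ with image $\{b:\nu(b)=b\otimes1_H\}$. Then $s$ induces $s_A\colon H\otimes A\to A\otimes H$, determined by $(i\otimes H)s_A=s(H\otimes i)$. Endow $A\otimes H$ with the coaction $A\otimes\Delta$ and put $\widehat{s_A}=(A\otimes c)(s_A\otimes H)$. The extension is \emph{cleft} if there is a convolution invertible morphism of right $H$-comodules $\gamma\colon(H,c)\to(B,s)$ (a \emph{cleft map}); it is \emph{$H$-Galois} if $\beta_B\colon B\otimes_AB\to B\otimes H$, $\beta_B(b\otimes b')=(b\otimes1_H)\nu(b')$,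 with the product $(\mu_B\otimes\mu_H)(B\otimes s\otimes H)$ on $B\otimes H$, is bijective; a \emph{normal basis} is a left $A$-linear isomorphism of right $H$-comodules $(A\otimes H,\widehat{s_A})\to(B,s)$. A \emph{weak action} of $H$ on $(A,s_A)$ is a map $\rho\colon H\otimes A\to A$ with $\rho(1_H\otimes a)=a$, $\rho(h\otimes1_A)=\epsilon(h)1_A$, $s_A(H\otimes\rho)=(\rho\otimes H)(H\otimes s_A)(c\otimes A)$ and $\rho(H\otimes\mu_A)=\mu_A(\rho\otimes\rho)(H\otimes s_A\otimes A)(\Delta\otimes A\otimes A)$. Given a left transposition $s_A$ on $A$, a weak action $\rho$, and a map $\sigma\colon H\otimes H\to A$, put $\chi=(\rho\otimes H)(H\otimes s_A)(\Delta\otimes A)$ and $\mathcal F=(\sigma\otimes\mu_H)\Delta_{H\otimes^cH}$. Suppose that $\sigma$ is normal ($\sigma(1_H\otimes h)=\sigma(h\otimes1_H)=\epsilon(h)1_A$), is compatible with $s_A$, i.e. $(\sigma\otimes H)(H\otimes c)(c\otimes H)=s_A(H\otimes\sigma)$, and satisfies the cocycle condition $$\mu_A(\rho\otimes A)(H\otimes\sigma\otimes\sigma)(H^{\otimes4}\otimes\mu_H)(H^{\otimes2}\otimes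 c\otimes H^{\otimes2})(H\otimes c\otimes c\otimes H)(\Delta\otimes\Delta\otimes\Delta)=\mu_A(A\otimes\sigma)(\mathcal F\otimes H)$$ and the twisted module condition $$\mu_A(\rho\otimes A)(H\otimes\rho\otimes\sigma)(H^{\otimes2}\otimes s_A\otimes H)(H^{\otimes3}\otimes s_A)(\Delta_{H\otimes^cH}\otimes A)=\mu_A(A\otimes\rho)(\mathcal F\otimes A).$$ Then the \emph{crossed product} $A\#^{s_A}_{\rho,\sigma}H$ is $A\otimes H$ with the multiplication $(\mu_A\otimes H)(\mu_A\otimes\mathcal F)(A\otimes\chi\otimes H)$ and unit $1_A\otimes1_H$. \textbf{Theorem.} Let $H$ be a braided Hopf algebra and let $(i\colon A\hookrightarrow B,s)$ be an $H$-extension. The following are equivalent: \begin{enumerate} \item $(i,s)$ is cleft; \item $(i,s)$ is $H$-Galois and has a normal basis; \item there are a crossed product $A\#_{\rho,\sigma}^{s_A}H$ with $\sigma\colon H\otimes^cH\to A$ convolution invertible, and a left $A$-linear isomorphism of right $H$-comodule algebras $(B,s)\to(A\#_{\rho,\sigma}^{s_A}H,\widehat{s_A})$. \end{enumerate} Furthermore,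 let $\gamma$ be a cleft map with $\gamma(1_H)=1_B$ and let $\gamma^{-1}$ be its convolution inverse. Then: \begin{enumerate} \item[(4)] $\phi\colon A\otimes H\to B$, $\phi(a\otimes h)=i(a)\gamma(h)$, is a normal basis of $B$. \item[(5)] The maps $\rho(h\otimes a)=(A\otimes\epsilon)\phi^{-1}(\gamma(h)i(a))$ and $\sigma(h\otimes l)=(A\otimes\epsilon)\phi^{-1}(\gamma(h)\gamma(l))$ define a crossed product $A\#_{\rho,\sigma}^{s_A}H$ with $\sigma$ convolution invertible, for which $\phi^{-1}$ is an isomorphism as in (3); they are the only such pair for which $\phi^{-1}$ is an isomorphism as in (3); and they satisfy $$i\circ\rho=\mu_B\circ(\mu_B\otimes B)\circ(\gamma\otimes i\otimes\gamma^{-1})\circ(H\otimes s_A)\circ(\Delta\otimes A)$$ and $$i\circ\sigma=\mu_B\circ(\mu_B\otimes\gamma^{-1})\circ(\gamma\otimes\gamma\otimes\mu_H)\circ\Delta_{H\otimes^cH}.$$ \end{enumerate} -/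

import Mathlib

open scoped TensorProduct

noncomputable section

namespace BraidedHopf

section Tensor

variable {k : Type*} [Field k]
  {V W X Y Z P Q : Type*}
  [AddCommGroup V] [Module k V] [AddCommGroup W] [Module k W]
  [AddCommGroup X] [Module k X] [AddCommGroup Y] [Module k Y]
  [AddCommGroup Z] [Module k Z] [AddCommGroup P] [Module k P] [AddCommGroup Q] [Module k Q]

/-- `(s ⊗ W) ∘ (V ⊗ t) : V ⊗ W ⊗ X → X ⊗ V ⊗ W`. -/
def slideL (s : V ⊗[k] X →ₗ[k] X ⊗[k] V) (t : W ⊗[k] X →ₗ[k] X ⊗[k] W) :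
    (V ⊗[k] W) ⊗[k] X →ₗ[k] X ⊗[k] (V ⊗[k] W) :=
  (TensorProduct.assoc k X V W).toLinearMap ∘ₗ s.rTensor W ∘ₗ
    (TensorProduct.assoc k V X W).symm.toLinearMap ∘ₗ t.lTensor V ∘ₗ
    (TensorProduct.assoc k V W X).toLinearMap

/-- `(X ⊗ t) ∘ (s ⊗ Y) : V ⊗ X ⊗ Y → X ⊗ Y ⊗ V`. -/
def slideR (s : V ⊗[k] X →ₗ[k] X ⊗[k] V) (t : V ⊗[k] Y →ₗ[k] Y ⊗[k] V) :
    V ⊗[k] (X ⊗[k] Y) →ₗ[k] (X ⊗[k] Y) ⊗[k] V :=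
  (TensorProduct.assoc k X Y V).symm.toLinearMap ∘ₗ t.lTensor X ∘ₗ
    (TensorProduct.assoc k X V Y).toLinearMap ∘ₗ s.rTensor Y ∘ₗ
    (TensorProduct.assoc k V X Y).symm.toLinearMap

/-- `X ⊗ f ⊗ W : X ⊗ Y ⊗ Z ⊗ W → X ⊗ P ⊗ Q ⊗ W`, for `f : Y ⊗ Z → P ⊗ Q`. -/
def mid (X W : Type*) [AddCommGroup X] [Module k X] [AddCommGroup W] [Module k W]
    (f : Y ⊗[k] Z →ₗ[k] P ⊗[k] Q) :
    (X ⊗[k] Y) ⊗[k] (Z ⊗[k] W) →ₗ[k] (X ⊗[k] P) ⊗[k] (Q ⊗[k] W) :=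
  (TensorProduct.assoc k X P (Q ⊗[k] W)).symm.toLinearMap ∘ₗ
    ((TensorProduct.assoc k P Q W).toLinearMap ∘ₗ f.rTensor W ∘ₗ
      (TensorProduct.assoc k Y Z W).symm.toLinearMap).lTensor X ∘ₗ
    (TensorProduct.assoc k X Y (Z ⊗[k] W)).toLinearMap

end Tensor

section Compat

variable {k : Type*} [Field k]

/-- A map `c : V ⊗ W → W ⊗ V` is compatible with the algebra structure of its left factor `V`. -/
structure AlgCompatLeft {V W : Type*} [Ring V] [Algebra k V] [AddCommGroup W] [Module k W]
    (c : V ⊗[k] W →ₗ[k] W ⊗[k] V) : Prop where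
  unit : ∀ w : W, c (1 ⊗ₜ[k] w) = w ⊗ₜ[k] 1
  mul : c ∘ₗ (LinearMap.mul' k V).rTensor W = (LinearMap.mul' k V).lTensor W ∘ₗ slideL c c

/-- A map `c : V ⊗ W → W ⊗ V` is compatible with the algebra structure of its right factor `W`. -/
structure AlgCompatRight {V W : Type*} [AddCommGroup V] [Module k V] [Ring W] [Algebra k W]
    (c : V ⊗[k] W →ₗ[k] W ⊗[k] V) : Prop where
  unit : ∀ v : V, c (v ⊗ₜ[k] 1) = 1 ⊗ₜ[k] v
  mul : c ∘ₗ (LinearMap.mul' k W).lTensor V = (LinearMap.mul' k W).rTensor V ∘ₗ slideR c c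

/-- A map `c : V ⊗ W → W ⊗ V` is compatible with the coalgebra structure of its left
factor `V`. -/
structure CoalgCompatLeft {V W : Type*} [AddCommGroup V] [Module k V] [Coalgebra k V]
    [AddCommGroup W] [Module k W] (c : V ⊗[k] W →ₗ[k] W ⊗[k] V) : Prop where
  counit : (TensorProduct.rid k W).toLinearMap ∘ₗ (Coalgebra.counit (R := k) (A := V)).lTensor W ∘ₗ
      c = (TensorProduct.lid k W).toLinearMap ∘ₗ (Coalgebra.counit (R := k) (A := V)).rTensor W
  comul : (Coalgebra.comul (R := k) (A := V)).lTensor W ∘ₗ c =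
      slideL c c ∘ₗ (Coalgebra.comul (R := k) (A := V)).rTensor W

/-- A map `c : V ⊗ W → W ⊗ V` is compatible with the coalgebra structure of its right
factor `W`. -/
structure CoalgCompatRight {V W : Type*} [AddCommGroup V] [Module k V]
    [AddCommGroup W] [Module k W] [Coalgebra k W] (c : V ⊗[k] W →ₗ[k] W ⊗[k] V) : Prop where
  counit : (TensorProduct.lid k V).toLinearMap ∘ₗ (Coalgebra.counit (R := k) (A := W)).rTensor V ∘ₗ
      c = (TensorProduct.rid k V).toLinearMap ∘ₗ (Coalgebra.counit (R := k) (A := W)).lTensor V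
  comul : (Coalgebra.comul (R := k) (A := W)).rTensor V ∘ₗ c =
      slideR c c ∘ₗ (Coalgebra.comul (R := k) (A := W)).lTensor V

/-- The multiplication of the twisted tensor product of algebras `A ⊗_s B`. -/
def twistedMul {A B : Type*} [Ring A] [Algebra k A] [Ring B] [Algebra k B]
    (s : B ⊗[k] A →ₗ[k] A ⊗[k] B) : (A ⊗[k] B) ⊗[k] (A ⊗[k] B) →ₗ[k] A ⊗[k] B :=
  TensorProduct.map (LinearMap.mul' k A) (LinearMap.mul' k B) ∘ₗ mid A B s

/-- The comultiplication of the twisted tensor product of coalgebras `C ⊗^c D`, for given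
comultiplications of `C` and `D`. -/
def twistedComul {C D : Type*} [AddCommGroup C] [Module k C] [AddCommGroup D] [Module k D]
    (c : C ⊗[k] D →ₗ[k] D ⊗[k] C) (ΔC : C →ₗ[k] C ⊗[k] C) (ΔD : D →ₗ[k] D ⊗[k] D) :
    C ⊗[k] D →ₗ[k] (C ⊗[k] D) ⊗[k] (C ⊗[k] D) :=
  mid C D c ∘ₗ TensorProduct.map ΔC ΔD

/-- `f` and `g` are mutually inverse for the convolution product `μ_B ∘ (f ⊗ g) ∘ Δ`, whose unit is
`η_B ∘ ε`, where `Δ` and `ε` are the comultiplication and the counit of `C`. -/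
structure IsConvInverse {C B : Type*} [AddCommGroup C] [Module k C] [Ring B] [Algebra k B]
    (Δ : C →ₗ[k] C ⊗[k] C) (ε : C →ₗ[k] k) (f g : C →ₗ[k] B) : Prop where
  mul_right : LinearMap.mul' k B ∘ₗ TensorProduct.map f g ∘ₗ Δ = Algebra.linearMap k B ∘ₗ ε
  mul_left : LinearMap.mul' k B ∘ₗ TensorProduct.map g f ∘ₗ Δ = Algebra.linearMap k B ∘ₗ ε

end Compat

section Braided

variable {k : Type*} [Field k] {H : Type*} [Ring H] [Algebra k H] [Coalgebra k H]

/-- The comultiplication of `H ⊗^c H`. -/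
def comul₂ (c : H ⊗[k] H →ₗ[k] H ⊗[k] H) : H ⊗[k] H →ₗ[k] (H ⊗[k] H) ⊗[k] (H ⊗[k] H) :=
  twistedComul c Coalgebra.comul Coalgebra.comul

/-- The counit `ε ⊗ ε` of `H ⊗^c H`. -/
def counit₂ (k H : Type*) [Field k] [Ring H] [Algebra k H] [Coalgebra k H] : H ⊗[k] H →ₗ[k] k :=
  LinearMap.mul' k k ∘ₗ TensorProduct.map Coalgebra.counit Coalgebra.counit

/-- The algebra and coalgebra `H`, with braid `c`, is a braided bialgebra. -/
structure IsBraidedBialgebra (c : H ⊗[k] H →ₗ[k] H ⊗[k] H) : Prop where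
  bijective : Function.Bijective c
  /-- The braid equation `(c ⊗ H) ∘ (H ⊗ c) ∘ (c ⊗ H) = (H ⊗ c) ∘ (c ⊗ H) ∘ (H ⊗ c)`. -/
  braid : slideL c c ∘ₗ c.rTensor H = c.lTensor H ∘ₗ slideL c c
  algLeft : AlgCompatLeft c
  algRight : AlgCompatRight c
  coalgLeft : CoalgCompatLeft c
  coalgRight : CoalgCompatRight c
  comul_one : Coalgebra.comul (R := k) (1 : H) = 1 ⊗ₜ[k] 1
  counit_one : Coalgebra.counit (R := k) (1 : H) = 1
  counit_mul : ∀ x y : H, Coalgebra.counit (R := k) (x * y) =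
    Coalgebra.counit (R := k) x * Coalgebra.counit (R := k) y
  comul_mul : Coalgebra.comul ∘ₗ LinearMap.mul' k H =
    TensorProduct.map (LinearMap.mul' k H) (LinearMap.mul' k H) ∘ₗ comul₂ c

/-- A braided Hopf algebra is a braided bialgebra such that the identity is convolution
invertible. -/
structure IsBraidedHopfAlgebra (c : H ⊗[k] H →ₗ[k] H ⊗[k] H) : Prop
    extends IsBraidedBialgebra c where
  exists_antipode : ∃ S : H →ₗ[k] H,
    IsConvInverse Coalgebra.comul Coalgebra.counit (LinearMap.id : H →ₗ[k] H) S

/-- `(V, s)` is a left `H`-space. -/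
structure IsLeftSpace {V : Type*} [AddCommGroup V] [Module k V]
    (c : H ⊗[k] H →ₗ[k] H ⊗[k] H) (s : H ⊗[k] V →ₗ[k] V ⊗[k] H) : Prop where
  bijective : Function.Bijective s
  alg : AlgCompatLeft s
  coalg : CoalgCompatLeft s
  /-- `(s ⊗ H) ∘ (H ⊗ s) ∘ (c ⊗ V) = (V ⊗ c) ∘ (s ⊗ H) ∘ (H ⊗ s)`. -/
  braid : slideL s s ∘ₗ c.rTensor V = c.lTensor V ∘ₗ slideL s s

/-- `s` is a left transposition of `H` on the algebra `A`. -/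
structure IsTransposition {A : Type*} [Ring A] [Algebra k A]
    (c : H ⊗[k] H →ₗ[k] H ⊗[k] H) (s : H ⊗[k] A →ₗ[k] A ⊗[k] H) : Prop
    extends IsLeftSpace c s where
  algRight : AlgCompatRight s

/-- `ν` is a (coassociative and counitary) right coaction of `H` on `V`. -/
structure IsCoaction {V : Type*} [AddCommGroup V] [Module k V] (ν : V →ₗ[k] V ⊗[k] H) : Prop where
  coassoc : (TensorProduct.assoc k V H H).toLinearMap ∘ₗ ν.rTensor H ∘ₗ ν =
    (Coalgebra.comul (R := k) (A := H)).lTensor V ∘ₗ ν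
  counit : (TensorProduct.rid k V).toLinearMap ∘ₗ
    (Coalgebra.counit (R := k) (A := H)).lTensor V ∘ₗ ν = LinearMap.id

/-- `(B, s)`, with coaction `ν`, is a right `H`-comodule algebra. -/
structure IsComoduleAlgebra {B : Type*} [Ring B] [Algebra k B]
    (c : H ⊗[k] H →ₗ[k] H ⊗[k] H) (s : H ⊗[k] B →ₗ[k] B ⊗[k] H) (ν : B →ₗ[k] B ⊗[k] H) : Prop where
  coaction : IsCoaction ν
  transposition : IsTransposition c s
  /-- `(ν ⊗ H) ∘ s = (B ⊗ c) ∘ (s ⊗ H) ∘ (H ⊗ ν)`. -/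
  braided : ν.rTensor H ∘ₗ s = slideR s c ∘ₗ ν.lTensor H
  map_mul : ν ∘ₗ LinearMap.mul' k B = twistedMul s ∘ₗ TensorProduct.map ν ν
  map_one : ν 1 = 1 ⊗ₜ[k] 1

variable {A : Type*} [Ring A] [Algebra k A] {B : Type*} [Ring B] [Algebra k B]

/-- `(i : A ↪ B, s)` is an `H`-extension of `A`. -/
structure IsExtension (c : H ⊗[k] H →ₗ[k] H ⊗[k] H) (s : H ⊗[k] B →ₗ[k] B ⊗[k] H)
    (ν : B →ₗ[k] B ⊗[k] H) (i : A →ₐ[k] B) : Prop where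
  comoduleAlgebra : IsComoduleAlgebra c s ν
  injective : Function.Injective i
  /-- The image of `i` is the set of coinvariant elements of `B`. -/
  range_eq : ∀ b : B, b ∈ Set.range i ↔ ν b = b ⊗ₜ[k] 1

/-! ### Crossed products -/

/-- `ρ` is a weak action of `H` on `(A, s)`. -/
structure IsWeakAction (c : H ⊗[k] H →ₗ[k] H ⊗[k] H) (s : H ⊗[k] A →ₗ[k] A ⊗[k] H)
    (ρ : H ⊗[k] A →ₗ[k] A) : Prop where
  one_act : ∀ a : A, ρ (1 ⊗ₜ[k] a) = a
  /-- `s ∘ (H ⊗ ρ) = (ρ ⊗ H) ∘ (H ⊗ s) ∘ (c ⊗ A)`. -/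
  braided : s ∘ₗ ρ.lTensor H = ρ.rTensor H ∘ₗ slideR c s
  /-- `ρ ∘ (H ⊗ μ) = μ ∘ (ρ ⊗ ρ) ∘ (H ⊗ s ⊗ A) ∘ (Δ ⊗ A ⊗ A)`. -/
  act_mul : ρ ∘ₗ (LinearMap.mul' k A).lTensor H =
    LinearMap.mul' k A ∘ₗ TensorProduct.map ρ ρ ∘ₗ mid H A s ∘ₗ
      (Coalgebra.comul (R := k) (A := H)).rTensor (A ⊗[k] A)
  act_one : ∀ h : H, ρ (h ⊗ₜ[k] 1) = algebraMap k A (Coalgebra.counit h)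

/-- `χ = (ρ ⊗ H) ∘ (H ⊗ s) ∘ (Δ ⊗ A)`. -/
def crossedχ (s : H ⊗[k] A →ₗ[k] A ⊗[k] H) (ρ : H ⊗[k] A →ₗ[k] A) : H ⊗[k] A →ₗ[k] A ⊗[k] H :=
  ρ.rTensor H ∘ₗ (TensorProduct.assoc k H A H).symm.toLinearMap ∘ₗ s.lTensor H ∘ₗ
    (TensorProduct.assoc k H H A).toLinearMap ∘ₗ (Coalgebra.comul (R := k) (A := H)).rTensor A

/-- `ℱ = (σ ⊗ μ) ∘ (H ⊗ c ⊗ H) ∘ (Δ ⊗ Δ)`. -/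
def crossedF (c : H ⊗[k] H →ₗ[k] H ⊗[k] H) (σ : H ⊗[k] H →ₗ[k] A) : H ⊗[k] H →ₗ[k] A ⊗[k] H :=
  TensorProduct.map σ (LinearMap.mul' k H) ∘ₗ comul₂ c

/-- The multiplication `(μ ⊗ H) ∘ (μ ⊗ ℱ) ∘ (A ⊗ χ ⊗ H)` of the crossed product on `A ⊗ H`. -/
def crossedMul (c : H ⊗[k] H →ₗ[k] H ⊗[k] H) (s : H ⊗[k] A →ₗ[k] A ⊗[k] H)
    (ρ : H ⊗[k] A →ₗ[k] A) (σ : H ⊗[k] H →ₗ[k] A) :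
    (A ⊗[k] H) ⊗[k] (A ⊗[k] H) →ₗ[k] A ⊗[k] H :=
  (LinearMap.mul' k A).rTensor H ∘ₗ (TensorProduct.assoc k A A H).symm.toLinearMap ∘ₗ
    TensorProduct.map (LinearMap.mul' k A) (crossedF c σ) ∘ₗ mid A H (crossedχ s ρ)

/-- The cocycle condition: with `(h₁ ⊗ l₁ ⊗ m₁) ⊗ (h₂ ⊗ l₂ ⊗ m₂)` the comultiplication of
`h ⊗ l ⊗ m` in `H ⊗^c H ⊗^c H` and `(h₁ ⊗ l₁) ⊗ (h₂ ⊗ l₂)` that of `h ⊗ l` in `H ⊗^c H`,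
`ρ(h₁ ⊗ σ(l₁ ⊗ m₁)) σ(h₂ ⊗ l₂ m₂) = σ(h₁ ⊗ l₁) σ(h₂ l₂ ⊗ m)`. -/
def CocycleCondition (c : H ⊗[k] H →ₗ[k] H ⊗[k] H) (ρ : H ⊗[k] A →ₗ[k] A)
    (σ : H ⊗[k] H →ₗ[k] A) : Prop :=
  LinearMap.mul' k A ∘ₗ
      TensorProduct.map (ρ ∘ₗ σ.lTensor H) (σ ∘ₗ (LinearMap.mul' k H).lTensor H) ∘ₗ
      twistedComul (slideR c c) Coalgebra.comul (comul₂ c) =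
    LinearMap.mul' k A ∘ₗ σ.lTensor A ∘ₗ (TensorProduct.assoc k A H H).toLinearMap ∘ₗ
      (crossedF c σ).rTensor H ∘ₗ (TensorProduct.assoc k H H H).symm.toLinearMap

/-- The twisted module condition: with `(h₁ ⊗ l₁) ⊗ (h₂ ⊗ l₂)` the comultiplication of `h ⊗ l` in
`H ⊗^c H` and `a' ⊗ (h₂' ⊗ l₂') = (s ⊗ H)(H ⊗ s)(h₂ ⊗ l₂ ⊗ a)`,
`ρ(h₁ ⊗ ρ(l₁ ⊗ a')) σ(h₂' ⊗ l₂') = σ(h₁ ⊗ l₁) ρ(h₂ l₂ ⊗ a)`. -/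
def TwistedModuleCondition (c : H ⊗[k] H →ₗ[k] H ⊗[k] H) (s : H ⊗[k] A →ₗ[k] A ⊗[k] H)
    (ρ : H ⊗[k] A →ₗ[k] A) (σ : H ⊗[k] H →ₗ[k] A) : Prop :=
  LinearMap.mul' k A ∘ₗ
      TensorProduct.map (ρ ∘ₗ ρ.lTensor H ∘ₗ (TensorProduct.assoc k H H A).toLinearMap) σ ∘ₗ
      (TensorProduct.assoc k (H ⊗[k] H) A (H ⊗[k] H)).symm.toLinearMap ∘ₗ
      (slideL s s).lTensor (H ⊗[k] H) ∘ₗ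
      (TensorProduct.assoc k (H ⊗[k] H) (H ⊗[k] H) A).toLinearMap ∘ₗ (comul₂ c).rTensor A =
    LinearMap.mul' k A ∘ₗ ρ.lTensor A ∘ₗ (TensorProduct.assoc k A H A).toLinearMap ∘ₗ
      (crossedF c σ).rTensor A

/-- The data for which the crossed product `A #_{ρ,σ}^s H` is defined: a left transposition `s`, a
weak `s`-action `ρ`, and a normal cocycle `σ` compatible with `s` that satisfies the twisted module
condition. -/
structure IsCrossedSystem (c : H ⊗[k] H →ₗ[k] H ⊗[k] H) (s : H ⊗[k] A →ₗ[k] A ⊗[k] H)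
    (ρ : H ⊗[k] A →ₗ[k] A) (σ : H ⊗[k] H →ₗ[k] A) : Prop where
  transposition : IsTransposition c s
  weakAction : IsWeakAction c s ρ
  normal_left : ∀ h : H, σ (1 ⊗ₜ[k] h) = algebraMap k A (Coalgebra.counit h)
  normal_right : ∀ h : H, σ (h ⊗ₜ[k] 1) = algebraMap k A (Coalgebra.counit h)
  cocycle : CocycleCondition c ρ σ
  twistedModule : TwistedModuleCondition c s ρ σ
  /-- `(σ ⊗ H) ∘ (H ⊗ c) ∘ (c ⊗ H) = s ∘ (H ⊗ σ)`. -/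
  compatible : σ.rTensor H ∘ₗ slideR c c = s ∘ₗ σ.lTensor H

/-- The coaction `A ⊗ Δ` of `H` on `A ⊗ H`. -/
def freeCoaction (k A H : Type*) [Field k] [Ring A] [Algebra k A] [Ring H] [Algebra k H]
    [Coalgebra k H] : A ⊗[k] H →ₗ[k] (A ⊗[k] H) ⊗[k] H :=
  (TensorProduct.assoc k A H H).symm.toLinearMap ∘ₗ (Coalgebra.comul (R := k) (A := H)).lTensor A

/-- The transposition `ŝ = (A ⊗ c) ∘ (s ⊗ H)` of `H` on `A ⊗ H`. -/
def hatTransposition (c : H ⊗[k] H →ₗ[k] H ⊗[k] H) (s : H ⊗[k] A →ₗ[k] A ⊗[k] H) :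
    H ⊗[k] (A ⊗[k] H) →ₗ[k] (A ⊗[k] H) ⊗[k] H :=
  slideR s c

/-! ### The transposition induced on `A` and the canonical map of an extension -/

section Induced

variable {c : H ⊗[k] H →ₗ[k] H ⊗[k] H} {s : H ⊗[k] B →ₗ[k] B ⊗[k] H}
  {ν : B →ₗ[k] B ⊗[k] H} {i : A →ₐ[k] B}

theorem slideR_coinvariant (hH : IsBraidedBialgebra c) (h : H) (b : B) :
    slideR s c (h ⊗ₜ[k] (b ⊗ₜ[k] (1 : H))) =
      ((TensorProduct.mk k B H).flip 1).rTensor H (s (h ⊗ₜ[k] b)) := by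
  have key : ∀ t : B ⊗[k] H, (TensorProduct.assoc k B H H).symm
      (c.lTensor B (TensorProduct.assoc k B H H (t ⊗ₜ[k] (1 : H)))) =
      ((TensorProduct.mk k B H).flip 1).rTensor H t := by
    intro t
    induction t with
    | zero => simp
    | tmul x y => simp [hH.algRight.unit]
    | add x y hx hy => simp [TensorProduct.add_tmul, hx, hy]
  simpa [slideR] using key (s (h ⊗ₜ[k] b))

/-- `s(H ⊗ i(A)) ⊆ i(A) ⊗ H`. -/
theorem transposition_mem_range (hH : IsBraidedBialgebra c) (hE : IsExtension c s ν i)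
    (x : H ⊗[k] A) :
    s (i.toLinearMap.lTensor H x) ∈ LinearMap.range (i.toLinearMap.rTensor H) := by
  have hex : Function.Exact i.toLinearMap (ν - (TensorProduct.mk k B H).flip 1) := by
    intro b
    rw [LinearMap.sub_apply, sub_eq_zero]
    exact (hE.range_eq b).symm
  have hex' := Module.Flat.rTensor_exact H hex
  induction x with
  | zero => simp
  | add x y hx hy => rw [map_add, map_add]; exact Submodule.add_mem _ hx hy
  | tmul h a =>
    rw [LinearMap.mem_range]
    refine (hex' _).1 ?_
    have h1 : ν (i a) = i a ⊗ₜ[k] 1 := (hE.range_eq _).1 ⟨a, rfl⟩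
    have h2 := LinearMap.congr_fun hE.comoduleAlgebra.braided (h ⊗ₜ[k] i a)
    simp only [LinearMap.comp_apply, LinearMap.lTensor_tmul, h1] at h2
    rw [slideR_coinvariant hH] at h2
    rw [LinearMap.rTensor_sub, LinearMap.sub_apply, sub_eq_zero]
    simpa using h2

theorem rTensor_injective (hE : IsExtension c s ν i) :
    Function.Injective (i.toLinearMap.rTensor H) :=
  Module.Flat.rTensor_preserves_injective_linearMap _ hE.injective

/-- The map `s_A : H ⊗ A → A ⊗ H` induced by `s`. -/
def induced (hH : IsBraidedBialgebra c) (hE : IsExtension c s ν i) : H ⊗[k] A →ₗ[k] A ⊗[k] H :=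
  (LinearEquiv.ofInjective (i.toLinearMap.rTensor H) (rTensor_injective hE)).symm.toLinearMap ∘ₗ
    (s ∘ₗ i.toLinearMap.lTensor H).codRestrict _ (transposition_mem_range hH hE)

/-- `(i ⊗ H) ∘ s_A = s ∘ (H ⊗ i)`, which determines `s_A`. -/
theorem induced_spec (hH : IsBraidedBialgebra c) (hE : IsExtension c s ν i) :
    i.toLinearMap.rTensor H ∘ₗ induced hH hE = s ∘ₗ i.toLinearMap.lTensor H := by
  ext1
  refine LinearMap.ext fun h => LinearMap.ext fun a => ?_
  have := LinearEquiv.apply_symm_apply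
    (LinearEquiv.ofInjective (i.toLinearMap.rTensor H) (rTensor_injective hE))
    ((s ∘ₗ i.toLinearMap.lTensor H).codRestrict _ (transposition_mem_range hH hE) (h ⊗ₜ[k] a))
  exact congrArg Subtype.val this

theorem twistedMul_one_left (hB : IsComoduleAlgebra c s ν) (b : B) (t : B ⊗[k] H) :
    twistedMul s ((b ⊗ₜ[k] (1 : H)) ⊗ₜ[k] t) = b • t := by
  induction t with
  | zero => simp
  | add x y hx hy => rw [TensorProduct.tmul_add, map_add, hx, hy, smul_add]
  | tmul x y =>
    simp [twistedMul, mid, hB.transposition.alg.unit, TensorProduct.smul_tmul']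

variable (i) in
/-- The subspace of `B ⊗ B` generated by the elements `b i(a) ⊗ b' - b ⊗ i(a) b'`. -/
def balanced : Submodule k (B ⊗[k] B) :=
  Submodule.span k {x | ∃ (b b' : B) (a : A),
    x = (b * i a) ⊗ₜ[k] b' - b ⊗ₜ[k] (i a * b')}

variable (i) in
/-- The tensor product `B ⊗_A B`. -/
abbrev TensorOver : Type _ := (B ⊗[k] B) ⧸ balanced i

variable (s ν) in
/-- The map `b ⊗ b' ↦ (b ⊗ 1) ν(b')` from `B ⊗ B` to `B ⊗_s H`. -/
def galoisMap₀ : B ⊗[k] B →ₗ[k] B ⊗[k] H :=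
  twistedMul s ∘ₗ TensorProduct.map ((TensorProduct.mk k B H).flip 1) ν

theorem balanced_le_ker (hE : IsExtension c s ν i) :
    balanced i ≤ LinearMap.ker (galoisMap₀ s ν) := by
  refine Submodule.span_le.2 ?_
  rintro _ ⟨b, b', a, rfl⟩
  have h1 : ν (i a) = i a ⊗ₜ[k] 1 := (hE.range_eq _).1 ⟨a, rfl⟩
  have h2 := LinearMap.congr_fun hE.comoduleAlgebra.map_mul (i a ⊗ₜ[k] b')
  simp only [LinearMap.comp_apply, LinearMap.mul'_apply, TensorProduct.map_tmul, h1,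
    twistedMul_one_left hE.comoduleAlgebra] at h2
  simp [galoisMap₀, twistedMul_one_left hE.comoduleAlgebra, h2, mul_smul]

/-- The canonical map `β_B : B ⊗_A B → B ⊗ H`, `β_B(b ⊗ b') = (b ⊗ 1) ν(b')`. -/
def galoisMap (hE : IsExtension c s ν i) : TensorOver (k := k) i →ₗ[k] B ⊗[k] H :=
  (balanced i).liftQ (galoisMap₀ s ν) (balanced_le_ker hE)

end Induced

/-! ### Cleft, Galois and normal extensions -/

/-- `γ` is a morphism of right `H`-comodules from `(H, c)` to `(B, s)` with convolution
inverse `γ'`. -/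
structure IsCleftMap (c : H ⊗[k] H →ₗ[k] H ⊗[k] H) (s : H ⊗[k] B →ₗ[k] B ⊗[k] H)
    (ν : B →ₗ[k] B ⊗[k] H) (γ γ' : H →ₗ[k] B) : Prop where
  colinear : ν ∘ₗ γ = γ.rTensor H ∘ₗ Coalgebra.comul
  braided : γ.rTensor H ∘ₗ c = s ∘ₗ γ.lTensor H
  inverse : IsConvInverse Coalgebra.comul Coalgebra.counit γ γ'

/-- The extension is cleft. -/
def IsCleft (c : H ⊗[k] H →ₗ[k] H ⊗[k] H) (s : H ⊗[k] B →ₗ[k] B ⊗[k] H)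
    (ν : B →ₗ[k] B ⊗[k] H) : Prop :=
  ∃ γ γ' : H →ₗ[k] B, IsCleftMap c s ν γ γ'

/-- The extension is `H`-Galois. -/
def IsGalois {c : H ⊗[k] H →ₗ[k] H ⊗[k] H} {s : H ⊗[k] B →ₗ[k] B ⊗[k] H}
    {ν : B →ₗ[k] B ⊗[k] H} {i : A →ₐ[k] B} (hE : IsExtension c s ν i) : Prop :=
  Function.Bijective (galoisMap hE)

/-- `φ` is a normal basis: a left `A`-linear isomorphism of right `H`-comodules from
`(A ⊗ H, ŝ_A)` to `(B, s)`. -/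
structure IsNormalBasis (c : H ⊗[k] H →ₗ[k] H ⊗[k] H) (s : H ⊗[k] B →ₗ[k] B ⊗[k] H)
    (ν : B →ₗ[k] B ⊗[k] H) (i : A →ₐ[k] B) (sA : H ⊗[k] A →ₗ[k] A ⊗[k] H)
    (φ : A ⊗[k] H ≃ₗ[k] B) : Prop where
  linear : ∀ (a : A) (x : A ⊗[k] H), φ (a • x) = i a * φ x
  colinear : ν ∘ₗ φ.toLinearMap = φ.toLinearMap.rTensor H ∘ₗ freeCoaction k A H
  braided : φ.toLinearMap.rTensor H ∘ₗ hatTransposition c sA = s ∘ₗ φ.toLinearMap.lTensor H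

/-- `f` is an isomorphism of right `H`-comodule algebras from `(B, s)` to the crossed product
`(A #_{ρ,σ}^{s_A} H, ŝ_A)`, which is also left `A`-linear. -/
structure IsCrossedProductIso (c : H ⊗[k] H →ₗ[k] H ⊗[k] H) (s : H ⊗[k] B →ₗ[k] B ⊗[k] H)
    (ν : B →ₗ[k] B ⊗[k] H) (i : A →ₐ[k] B) (sA : H ⊗[k] A →ₗ[k] A ⊗[k] H)
    (ρ : H ⊗[k] A →ₗ[k] A) (σ : H ⊗[k] H →ₗ[k] A) (f : B ≃ₗ[k] A ⊗[k] H) : Prop where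
  map_one : f 1 = 1 ⊗ₜ[k] 1
  map_mul : ∀ b b' : B, f (b * b') = crossedMul c sA ρ σ (f b ⊗ₜ[k] f b')
  colinear : freeCoaction k A H ∘ₗ f.toLinearMap = f.toLinearMap.rTensor H ∘ₗ ν
  braided : f.toLinearMap.rTensor H ∘ₗ s = hatTransposition c sA ∘ₗ f.toLinearMap.lTensor H
  linear : ∀ (a : A) (b : B), f (i a * b) = a • f b

/-- `μ_B ∘ (μ_B ⊗ B) ∘ (γ ⊗ i ⊗ γ') ∘ (H ⊗ s_A) ∘ (Δ ⊗ A) : H ⊗ A → B`. -/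
def actionFormula (i : A →ₐ[k] B) (sA : H ⊗[k] A →ₗ[k] A ⊗[k] H) (γ γ' : H →ₗ[k] B) :
    H ⊗[k] A →ₗ[k] B :=
  LinearMap.mul' k B ∘ₗ (LinearMap.mul' k B).rTensor B ∘ₗ
    TensorProduct.map (TensorProduct.map γ i.toLinearMap) γ' ∘ₗ
    (TensorProduct.assoc k H A H).symm.toLinearMap ∘ₗ sA.lTensor H ∘ₗ
    (TensorProduct.assoc k H H A).toLinearMap ∘ₗ (Coalgebra.comul (R := k) (A := H)).rTensor A

/-- `μ_B ∘ (μ_B ⊗ γ') ∘ (γ ⊗ γ ⊗ μ_H) ∘ Δ_{H ⊗^c H} : H ⊗ H → B`. -/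
def cocycleFormula (c : H ⊗[k] H →ₗ[k] H ⊗[k] H) (γ γ' : H →ₗ[k] B) : H ⊗[k] H →ₗ[k] B :=
  LinearMap.mul' k B ∘ₗ TensorProduct.map (LinearMap.mul' k B) γ' ∘ₗ
    TensorProduct.map (TensorProduct.map γ γ) (LinearMap.mul' k H) ∘ₗ comul₂ c

/-- `A ⊗ ε : A ⊗ H → A`. -/
def idCounit (k A H : Type*) [Field k] [Ring A] [Algebra k A] [Ring H] [Algebra k H]
    [Coalgebra k H] : A ⊗[k] H →ₗ[k] A :=
  (TensorProduct.rid k A).toLinearMap ∘ₗ (Coalgebra.counit (R := k) (A := H)).lTensor A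

end Braided

end BraidedHopf

end

set_option linter.unusedSectionVars false

open scoped TensorProduct

noncomputable section

namespace BraidedHopf

/-! ### Convolution invertibility as bijectivity of an endomorphism -/

section Spread

variable {k : Type*} [Field k]

/-! For a coalgebra `C` and an algebra `R`, a linear map `f : C → R` is the same thing as a left
`R`-linear, right `C`-colinear endomorphism of `R ⊗ C`, namely `r ⊗ x ↦ r f(x₁) ⊗ x₂`. This turns
convolution into composition in the reverse order, so `f` is convolution invertible if and only if
its endomorphism is bijective (`spread_bijective`, `exists_isConvInverse_of_bijective`). The
invertibility of `γ` and of `σ`, and the Galois condition, are compared as bijectivity statements,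
without explicit inverses.

Galois versus cleft: let `φ` be a normal basis and `γ = φ(1 ⊗ -)`. Then `φ` identifies `B ⊗_A B`
with `B ⊗ H`, and `β_B` becomes the endomorphism of `γ`. Hence the extension is Galois exactly when
`γ` is convolution invertible (`isGalois_iff_spread_bijective`). Conversely, a cleft map yields a
normal basis because `b₀ γ⁻¹(b₁)` is coinvariant, so that `b ↦ b₀ γ⁻¹(b₁) ⊗ b₂` inverts `a ⊗ h ↦
i(a) γ(h)` (`IsCleftMap.basisMap_bijective`).

Cleft versus crossed product: if `γ(h) γ(l) = φ(σ(h₁ ⊗ l₁) ⊗ h₂ l₂)`, then on `B ⊗ H ≅ A ⊗ H ⊗ H`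
the endomorphism of `γ` is that of `σ` followed by `A` tensored with that of `id_H`. The last one is
bijective thanks to the antipode, so `γ` is invertible if and only if `σ` is
(`spread_bijective_iff`). This needs `H ⊗^c H` to be a coalgebra (`isCoalg_comul₂`).

The crossed product itself is the product of `B` read through `φ⁻¹`. Being colinear, `φ⁻¹` is
determined by `(A ⊗ ε) φ⁻¹` and `ν`, which gives `φ⁻¹(γ(h) i(a)) = χ(h ⊗ a)` and `φ⁻¹(γ(h) γ(l)) =
ℱ(h ⊗ l)`. Multiplicativity of `ρ`, the cocycle condition and the twisted module condition are then
associativity in `B` for the triples `γ, i, i`, then `γ, γ, γ`, then `γ, γ, i`. Uniqueness holds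
because `A ⊗ ε` recovers `ρ` and `σ` from products in the crossed product. -/

/-- A coalgebra structure given by unbundled maps. -/
structure IsCoalg {C : Type*} [AddCommGroup C] [Module k C] (Δ : C →ₗ[k] C ⊗[k] C)
    (ε : C →ₗ[k] k) : Prop where
  coassoc : (TensorProduct.assoc k C C C).toLinearMap ∘ₗ Δ.rTensor C ∘ₗ Δ = Δ.lTensor C ∘ₗ Δ
  rTensor_counit : ∀ x, ε.rTensor C (Δ x) = 1 ⊗ₜ[k] x
  lTensor_counit : ∀ x, ε.lTensor C (Δ x) = x ⊗ₜ[k] 1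

theorem isCoalg_comul (C : Type*) [AddCommGroup C] [Module k C] [Coalgebra k C] :
    IsCoalg (k := k) (C := C) Coalgebra.comul Coalgebra.counit where
  coassoc := Coalgebra.coassoc
  rTensor_counit := Coalgebra.rTensor_counit_comul
  lTensor_counit := Coalgebra.lTensor_counit_comul

variable {C : Type*} [AddCommGroup C] [Module k C] {R : Type*} [Ring R] [Algebra k R]
  {M : Type*} [AddCommGroup M] [Module k M]

/-- `R ⊗ C → M`, `r ⊗ x ↦ r • f x`. -/
def actMap [Module R M] [IsScalarTower k R M] (f : C →ₗ[k] M) : R ⊗[k] C →ₗ[k] M :=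
  TensorProduct.lift (Algebra.lsmul k k M).toLinearMap ∘ₗ f.lTensor R

theorem actMap_tmul [Module R M] [IsScalarTower k R M] (f : C →ₗ[k] M) (r : R) (x : C) :
    actMap f (r ⊗ₜ[k] x) = r • f x := by
  simp [actMap]

theorem actMap_smul [Module R M] [IsScalarTower k R M] (f : C →ₗ[k] M) (r : R) (t : R ⊗[k] C) :
    actMap f (r • t) = r • actMap f t := by
  induction t with
  | zero => simp
  | add x y hx hy => simp only [smul_add, map_add, hx, hy]
  | tmul a x => simp [TensorProduct.smul_tmul', actMap_tmul, mul_smul]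

theorem smul_rTensor (r : R) (f : C →ₗ[k] R) (t : C ⊗[k] M) :
    r • f.rTensor M t = (LinearMap.mulLeft k r ∘ₗ f).rTensor M t := by
  induction t with
  | zero => simp
  | add x y hx hy => simp only [smul_add, map_add, hx, hy]
  | tmul a x => simp [TensorProduct.smul_tmul']

/-- `R ⊗ C → R ⊗ C`, `r ⊗ x ↦ r f(x₁) ⊗ x₂`. -/
def spread (Δ : C →ₗ[k] C ⊗[k] C) (f : C →ₗ[k] R) : R ⊗[k] C →ₗ[k] R ⊗[k] C :=
  actMap (f.rTensor C ∘ₗ Δ)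

theorem spread_tmul (Δ : C →ₗ[k] C ⊗[k] C) (f : C →ₗ[k] R) (r : R) (x : C) :
    spread Δ f (r ⊗ₜ[k] x) = r • f.rTensor C (Δ x) := actMap_tmul _ _ _

theorem spread_smul (Δ : C →ₗ[k] C ⊗[k] C) (f : C →ₗ[k] R) (r : R) (t : R ⊗[k] C) :
    spread Δ f (r • t) = r • spread Δ f t := actMap_smul _ _ _

variable {Δ : C →ₗ[k] C ⊗[k] C} {ε : C →ₗ[k] k}

/-- `spread Δ f` sends `g(x₁) ⊗ x₂` to `(g * f)(x₁) ⊗ x₂`. -/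
theorem spread_rTensor (hC : IsCoalg Δ ε) (f g : C →ₗ[k] R) (x : C) :
    spread Δ f (g.rTensor C (Δ x)) =
      (LinearMap.mul' k R ∘ₗ TensorProduct.map g f ∘ₗ Δ).rTensor C (Δ x) := by
  have h1 : ∀ t : C ⊗[k] C, spread Δ f (g.rTensor C t) =
      ((LinearMap.mul' k R ∘ₗ TensorProduct.map g f).rTensor C ∘ₗ
        (TensorProduct.assoc k C C C).symm.toLinearMap) (Δ.lTensor C t) := by
    intro t
    induction t with
    | zero => simp
    | add x y hx hy => simp only [map_add, hx, hy]
    | tmul x y =>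
      simp only [LinearMap.rTensor_tmul, spread_tmul, LinearMap.lTensor_tmul]
      generalize Δ y = u
      induction u with
      | zero => simp
      | add x y hx hy => simp only [map_add, smul_add, TensorProduct.tmul_add, hx, hy]
      | tmul y z => simp [TensorProduct.smul_tmul']
  rw [h1]
  have h2 := LinearMap.congr_fun hC.coassoc x
  simp only [LinearMap.comp_apply, LinearEquiv.coe_coe] at h2
  rw [← h2]
  simp [LinearMap.rTensor_comp]

theorem rTensor_unit_counit (hC : IsCoalg Δ ε) (x : C) :
    (Algebra.linearMap k R ∘ₗ ε).rTensor C (Δ x) = 1 ⊗ₜ[k] x := by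
  rw [LinearMap.rTensor_comp_apply, hC.rTensor_counit]
  simp

/-- This is why `f` can be recovered from `f(x₁) ⊗ x₂`, hence from its spread. -/
theorem rid_lTensor_counit_rTensor (hC : IsCoalg Δ ε) (f : C →ₗ[k] M) (x : C) :
    TensorProduct.rid k M (ε.lTensor M (f.rTensor C (Δ x))) = f x := by
  have h : ε.lTensor M (f.rTensor C (Δ x)) = f.rTensor k (ε.lTensor C (Δ x)) := by
    generalize Δ x = t
    induction t with
    | zero => simp
    | add x y hx hy => simp only [map_add, hx, hy]
    | tmul x y => simp
  rw [h, hC.lTensor_counit]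
  simp

/-- New values multiply on the right, so `spread f ∘ spread g` belongs to the convolution product of
`g` with `f`, in this order. A one-sided convolution inverse therefore gives a one-sided inverse
map. -/
theorem spread_comp_spread (hC : IsCoalg Δ ε) {f g : C →ₗ[k] R}
    (h : LinearMap.mul' k R ∘ₗ TensorProduct.map g f ∘ₗ Δ = Algebra.linearMap k R ∘ₗ ε)
    (t : R ⊗[k] C) : spread Δ f (spread Δ g t) = t := by
  induction t with
  | zero => simp
  | add x y hx hy => simp only [map_add, hx, hy]
  | tmul r x =>
    rw [spread_tmul, spread_smul, spread_rTensor hC, h, rTensor_unit_counit hC,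
      TensorProduct.smul_tmul', smul_eq_mul, mul_one]

theorem spread_bijective (hC : IsCoalg Δ ε) {f g : C →ₗ[k] R} (h : IsConvInverse Δ ε f g) :
    Function.Bijective (spread Δ f) :=
  Function.bijective_iff_has_inverse.2
    ⟨spread Δ g, spread_comp_spread hC h.mul_right, spread_comp_spread hC h.mul_left⟩

/-- Coassociativity alone. It is needed so that the inverse of a bijective spread is again colinear.
-/
theorem spread_colinear (hC : IsCoalg Δ ε) (f : C →ₗ[k] R) (t : R ⊗[k] C) :
    (TensorProduct.assoc k R C C).symm (Δ.lTensor R (spread Δ f t)) =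
      (spread Δ f).rTensor C ((TensorProduct.assoc k R C C).symm (Δ.lTensor R t)) := by
  induction t with
  | zero => simp
  | add x y hx hy => simp only [map_add, hx, hy]
  | tmul r x =>
    have h2 := LinearMap.congr_fun hC.coassoc x
    simp only [LinearMap.comp_apply, LinearEquiv.coe_coe] at h2
    have e1 : ∀ u : C ⊗[k] C, (TensorProduct.assoc k R C C).symm
        (Δ.lTensor R (r • f.rTensor C u)) =
        ((LinearMap.mulLeft k r ∘ₗ f).rTensor C).rTensor C
          ((TensorProduct.assoc k C C C).symm (Δ.lTensor C u)) := by
      intro u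
      induction u with
      | zero => simp
      | add x y hx hy => simp only [map_add, smul_add, hx, hy]
      | tmul x y =>
        simp only [LinearMap.rTensor_tmul, TensorProduct.smul_tmul', LinearMap.lTensor_tmul]
        generalize Δ y = v
        induction v with
        | zero => simp
        | add x y hx hy => simp only [map_add, TensorProduct.tmul_add, hx, hy]
        | tmul y z => simp
    have e2 : ∀ u : C ⊗[k] C, (spread Δ f).rTensor C ((TensorProduct.assoc k R C C).symm
        (r ⊗ₜ[k] u)) = ((LinearMap.mulLeft k r ∘ₗ f).rTensor C).rTensor C (Δ.rTensor C u) := by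
      intro u
      induction u with
      | zero => simp
      | add x y hx hy => simp only [map_add, TensorProduct.tmul_add, hx, hy]
      | tmul x y => simp [spread_tmul, smul_rTensor]
    rw [spread_tmul, e1, LinearMap.lTensor_tmul, e2, ← h2, LinearEquiv.symm_apply_apply]

/-- The inverse bijection inherits `R`-linearity and colinearity, so it is itself the spread of some
`g`, which the counit extracts from its values on `1 ⊗ x`. -/
theorem exists_isConvInverse_of_bijective (hC : IsCoalg Δ ε) {f : C →ₗ[k] R}
    (h : Function.Bijective (spread Δ f)) : ∃ g : C →ₗ[k] R, IsConvInverse Δ ε f g := by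
  set e : R ⊗[k] C ≃ₗ[k] R ⊗[k] C := LinearEquiv.ofBijective (spread Δ f) h
  have hef : ∀ t, e.symm (spread Δ f t) = t := fun t => e.symm_apply_apply t
  have hfe : ∀ t, spread Δ f (e.symm t) = t := fun t => e.apply_symm_apply t
  have hsmul : ∀ (r : R) t, e.symm (r • t) = r • e.symm t := by
    intro r t
    rw [← hef (r • e.symm t), spread_smul, hfe]
  have hcol : ∀ t, (TensorProduct.assoc k R C C).symm (Δ.lTensor R (e.symm t)) =
      e.symm.toLinearMap.rTensor C ((TensorProduct.assoc k R C C).symm (Δ.lTensor R t)) := by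
    intro t
    conv_rhs => rw [← hfe t, spread_colinear hC]
    rw [← LinearMap.rTensor_comp_apply]
    have : e.symm.toLinearMap ∘ₗ spread Δ f = LinearMap.id := LinearMap.ext hef
    simp [this]
  let q : R ⊗[k] C →ₗ[k] R := (TensorProduct.rid k R).toLinearMap ∘ₗ ε.lTensor R
  have hq : ∀ t : R ⊗[k] C,
      q.rTensor C ((TensorProduct.assoc k R C C).symm (Δ.lTensor R t)) = t := by
    intro t
    induction t with
    | zero => simp
    | add x y hx hy => simp only [map_add, hx, hy]
    | tmul r x =>
      have : ∀ u : C ⊗[k] C, q.rTensor C ((TensorProduct.assoc k R C C).symm (r ⊗ₜ[k] u)) =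
          (TensorProduct.lid k C).toLinearMap.lTensor R (r ⊗ₜ[k] ε.rTensor C u) := by
        intro u
        induction u with
        | zero => simp
        | add x y hx hy => simp only [map_add, TensorProduct.tmul_add, hx, hy]
        | tmul x y => simp [q, TensorProduct.smul_tmul]
      rw [LinearMap.lTensor_tmul, this, hC.rTensor_counit]
      simp
  let g : C →ₗ[k] R := q ∘ₗ e.symm.toLinearMap ∘ₗ TensorProduct.mk k R C 1
  have hg : ∀ x, e.symm (1 ⊗ₜ[k] x) = g.rTensor C (Δ x) := by
    intro x
    rw [← hq (e.symm (1 ⊗ₜ[k] x)), hcol, LinearMap.lTensor_tmul, ← LinearMap.rTensor_comp_apply]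
    generalize Δ x = u
    induction u with
    | zero => simp
    | add x y hx hy => simp only [map_add, TensorProduct.tmul_add, hx, hy]
    | tmul x y => simp [g]
  -- Reduces both convolution identities to statements about composites of spreads.
  have conv_eq : ∀ p : C →ₗ[k] R, (∀ x, p.rTensor C (Δ x) = 1 ⊗ₜ[k] x) →
      p = Algebra.linearMap k R ∘ₗ ε := by
    intro p hp
    ext x
    rw [← rid_lTensor_counit_rTensor hC p x, hp]
    simp [Algebra.algebraMap_eq_smul_one]
  refine ⟨g, conv_eq _ fun x => ?_, conv_eq _ fun x => ?_⟩
  · rw [← spread_rTensor hC]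
    have hs : ∀ t, spread Δ g t = e.symm t := by
      intro t
      induction t with
      | zero => simp
      | add x y hx hy => simp only [map_add, hx, hy]
      | tmul r x =>
        rw [spread_tmul, ← hg, ← hsmul, TensorProduct.smul_tmul', smul_eq_mul, mul_one]
    rw [hs, ← hef (1 ⊗ₜ[k] x), spread_tmul, one_smul]
  · rw [← spread_rTensor hC, ← hg, hfe]

end Spread

/-! ### Operations on the first strands of a right-bracketed tensor product -/

section Tail

variable {k : Type*} [Field k]
  {V W X Y M N : Type*}
  [AddCommGroup V] [Module k V] [AddCommGroup W] [Module k W]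
  [AddCommGroup X] [Module k X] [AddCommGroup Y] [Module k Y]
  [AddCommGroup M] [Module k M] [AddCommGroup N] [Module k N]

/-- `f ⊗ M`, for `f : V ⊗ W → X ⊗ Y`, up to associativity. -/
def headMap (M : Type*) [AddCommGroup M] [Module k M] (f : V ⊗[k] W →ₗ[k] X ⊗[k] Y) :
    V ⊗[k] (W ⊗[k] M) →ₗ[k] X ⊗[k] (Y ⊗[k] M) :=
  (TensorProduct.assoc k X Y M).toLinearMap ∘ₗ f.rTensor M ∘ₗ
    (TensorProduct.assoc k V W M).symm.toLinearMap

/-- `d ⊗ M`, for `d : V → X ⊗ Y`, up to associativity. -/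
def headComul (M : Type*) [AddCommGroup M] [Module k M] (d : V →ₗ[k] X ⊗[k] Y) :
    V ⊗[k] M →ₗ[k] X ⊗[k] (Y ⊗[k] M) :=
  (TensorProduct.assoc k X Y M).toLinearMap ∘ₗ d.rTensor M

theorem assoc_tmul_right (t : X ⊗[k] Y) (m : M) :
    TensorProduct.assoc k X Y M (t ⊗ₜ[k] m) = ((TensorProduct.mk k Y M).flip m).lTensor X t := by
  induction t with
  | zero => simp
  | add x y hx hy => simp only [map_add, TensorProduct.add_tmul, hx, hy]
  | tmul x y => simp

/-- Interchange law: operations on disjoint strands commute. -/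
theorem headMap_natural (f : V ⊗[k] W →ₗ[k] X ⊗[k] Y) (g : M →ₗ[k] N) :
    headMap N f ∘ₗ (g.lTensor W).lTensor V = (g.lTensor Y).lTensor X ∘ₗ headMap M f := by
  ext v w m
  simp only [headMap, LinearMap.comp_apply, TensorProduct.AlgebraTensorModule.curry_apply,
    TensorProduct.curry_apply, LinearMap.coe_restrictScalars, LinearMap.lTensor_tmul,
    LinearEquiv.coe_coe, TensorProduct.assoc_symm_tmul, LinearMap.rTensor_tmul]
  generalize f (v ⊗ₜ[k] w) = t
  induction t with
  | zero => simp
  | add x y hx hy => simp only [map_add, TensorProduct.add_tmul, hx, hy]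
  | tmul x y => simp

theorem headComul_natural (d : V →ₗ[k] X ⊗[k] Y) (g : M →ₗ[k] N) :
    headComul N d ∘ₗ g.lTensor V = (g.lTensor Y).lTensor X ∘ₗ headComul M d := by
  ext v m
  simp only [headComul, LinearMap.comp_apply, TensorProduct.AlgebraTensorModule.curry_apply,
    TensorProduct.curry_apply, LinearMap.coe_restrictScalars, LinearMap.lTensor_tmul,
    LinearEquiv.coe_coe, LinearMap.rTensor_tmul]
  generalize d v = t
  induction t with
  | zero => simp
  | add x y hx hy => simp only [map_add, TensorProduct.add_tmul, hx, hy]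
  | tmul x y => simp

theorem headComul_lTensor (d : V →ₗ[k] X ⊗[k] Y) (g : M →ₗ[k] N) (t : V ⊗[k] M) :
    headComul N d (g.lTensor V t) = (g.lTensor Y).lTensor X (headComul M d t) :=
  LinearMap.congr_fun (headComul_natural d g) t

theorem headMap_tmul (f : V ⊗[k] W →ₗ[k] X ⊗[k] Y) (v : V) (w : W) (m : M) :
    headMap M f (v ⊗ₜ[k] (w ⊗ₜ[k] m)) =
      ((TensorProduct.mk k Y M).flip m).lTensor X (f (v ⊗ₜ[k] w)) := by
  simp [headMap, assoc_tmul_right]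

theorem headComul_tmul (d : V →ₗ[k] X ⊗[k] Y) (v : V) (m : M) :
    headComul M d (v ⊗ₜ[k] m) = ((TensorProduct.mk k Y M).flip m).lTensor X (d v) := by
  simp [headComul, assoc_tmul_right]

/-- Freezing the tail at an element lets an identity without a tail be transported to one with an
arbitrary tail. -/
theorem headMap_flip (f : V ⊗[k] W →ₗ[k] X ⊗[k] Y) (m : M) :
    headMap M f ∘ₗ ((TensorProduct.mk k W M).flip m).lTensor V =
      ((TensorProduct.mk k Y M).flip m).lTensor X ∘ₗ f := by
  ext v w
  simp [headMap_tmul]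

theorem headComul_flip (d : V →ₗ[k] X ⊗[k] Y) (m : M) :
    headComul M d ∘ₗ (TensorProduct.mk k V M).flip m =
      ((TensorProduct.mk k Y M).flip m).lTensor X ∘ₗ d := by
  ext v
  simp [headComul_tmul]

end Tail

/-! ### The coalgebra `H ⊗^c H` -/

section Comul

variable {k : Type*} [Field k] {H : Type*} [Ring H] [Algebra k H] [Coalgebra k H]
  {M : Type*} [AddCommGroup M] [Module k M] {c : H ⊗[k] H →ₗ[k] H ⊗[k] H}

/-- The compatibility axiom itself, with a tail `M` added so that it can be rewritten inside longer
tensor products. -/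
theorem headComul_comp_braid (hc : CoalgCompatRight c) :
    headComul (H ⊗[k] M) (Coalgebra.comul (R := k) (A := H)) ∘ₗ headMap M c =
      (headMap M c).lTensor H ∘ₗ headMap (H ⊗[k] M) c ∘ₗ
        (headComul M (Coalgebra.comul (R := k) (A := H))).lTensor H := by
  ext h l m
  have h1 := LinearMap.congr_fun hc.comul (h ⊗ₜ[k] l)
  replace h1 := congrArg (TensorProduct.assoc k H H H) h1
  have h2 : headComul H (Coalgebra.comul (R := k) (A := H)) (c (h ⊗ₜ[k] l)) =
      c.lTensor H (headMap H c (h ⊗ₜ[k] Coalgebra.comul (R := k) l)) := by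
    simpa [slideR, headComul, headMap] using h1
  have h3 := congrArg ((((TensorProduct.mk k H M).flip m).lTensor H).lTensor H) h2
  have n1 := LinearMap.congr_fun (headComul_natural (Coalgebra.comul (R := k) (A := H))
    ((TensorProduct.mk k H M).flip m)) (c (h ⊗ₜ[k] l))
  have n2 := LinearMap.congr_fun (headMap_natural c ((TensorProduct.mk k H M).flip m))
    (h ⊗ₜ[k] Coalgebra.comul (R := k) l)
  simp only [LinearMap.comp_apply, LinearMap.lTensor_tmul] at n1 n2
  simp only [TensorProduct.AlgebraTensorModule.curry_apply, TensorProduct.curry_apply,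
    LinearMap.coe_restrictScalars, LinearMap.comp_apply, LinearMap.lTensor_tmul, headMap_tmul,
    headComul_tmul]
  rw [n1, n2, h3, ← LinearMap.lTensor_comp_apply, ← LinearMap.lTensor_comp_apply, headMap_flip]

theorem comul_lTensor_comp_braid (hc : CoalgCompatLeft c) :
    (headComul M (Coalgebra.comul (R := k) (A := H))).lTensor H ∘ₗ headMap M c =
      headMap (H ⊗[k] M) c ∘ₗ (headMap M c).lTensor H ∘ₗ
        headComul (H ⊗[k] M) (Coalgebra.comul (R := k) (A := H)) := by
  ext h l m
  have h2 : (Coalgebra.comul (R := k) (A := H)).lTensor H (c (h ⊗ₜ[k] l)) =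
      headMap H c (c.lTensor H (headComul H (Coalgebra.comul (R := k) (A := H)) (h ⊗ₜ[k] l))) := by
    simpa [slideL, headComul, headMap] using LinearMap.congr_fun hc.comul (h ⊗ₜ[k] l)
  have h3 := congrArg ((((TensorProduct.mk k H M).flip m).lTensor H).lTensor H) h2
  have n2 := fun t => LinearMap.congr_fun (headMap_natural c ((TensorProduct.mk k H M).flip m)) t
  have n1 := LinearMap.congr_fun (headComul_natural (Coalgebra.comul (R := k) (A := H))
    ((TensorProduct.mk k H M).flip m)) (h ⊗ₜ[k] l)
  simp only [LinearMap.comp_apply, LinearMap.lTensor_tmul] at n1 n2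
  simp only [TensorProduct.AlgebraTensorModule.curry_apply, TensorProduct.curry_apply,
    LinearMap.coe_restrictScalars, LinearMap.comp_apply, headMap_tmul]
  rw [← LinearMap.lTensor_comp_apply, headComul_flip, LinearMap.lTensor_comp_apply, h3, ← n2,
    ← LinearMap.lTensor_comp_apply, ← headMap_flip, LinearMap.lTensor_comp_apply, ← n1]
  simp

theorem headComul_coassoc :
    headComul (H ⊗[k] M) (Coalgebra.comul (R := k) (A := H)) ∘ₗ headComul M Coalgebra.comul =
      (headComul M (Coalgebra.comul (R := k) (A := H))).lTensor H ∘ₗ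
        headComul M Coalgebra.comul := by
  ext h m
  have h2 : headComul H (Coalgebra.comul (R := k) (A := H)) (Coalgebra.comul (R := k) h) =
      (Coalgebra.comul (R := k) (A := H)).lTensor H (Coalgebra.comul (R := k) h) :=
    Coalgebra.coassoc_apply h
  have h3 := congrArg ((((TensorProduct.mk k H M).flip m).lTensor H).lTensor H) h2
  have n1 := LinearMap.congr_fun (headComul_natural (Coalgebra.comul (R := k) (A := H))
    ((TensorProduct.mk k H M).flip m)) (Coalgebra.comul (R := k) h)
  simp only [LinearMap.comp_apply] at n1
  simp only [TensorProduct.AlgebraTensorModule.curry_apply, TensorProduct.curry_apply,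
    LinearMap.coe_restrictScalars, LinearMap.comp_apply, headComul_tmul]
  rw [n1, h3, ← LinearMap.lTensor_comp_apply, ← LinearMap.lTensor_comp_apply, headComul_flip]

theorem assoc_comul₂ : (TensorProduct.assoc k H H (H ⊗[k] H)).toLinearMap ∘ₗ comul₂ c =
    (headMap H c).lTensor H ∘ₗ headComul (H ⊗[k] H) (Coalgebra.comul (R := k) (A := H)) ∘ₗ
      (Coalgebra.comul (R := k) (A := H)).lTensor H := by
  ext h l
  simp [comul₂, twistedComul, mid, headComul, headMap]

/-- Brings `Δ_{H ⊗^c H}` applied to a left factor into right-bracketed form, where everything is a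
composite of `headMap`, `headComul` and `lTensor`. -/
theorem assoc_rTensor_comul₂ :
    ((TensorProduct.assoc k H H M).toLinearMap.lTensor H).lTensor H ∘ₗ
      (TensorProduct.assoc k H H ((H ⊗[k] H) ⊗[k] M)).toLinearMap ∘ₗ
      (TensorProduct.assoc k (H ⊗[k] H) (H ⊗[k] H) M).toLinearMap ∘ₗ (comul₂ c).rTensor M =
    (headMap (H ⊗[k] M) c).lTensor H ∘ₗ
      headComul (H ⊗[k] (H ⊗[k] M)) (Coalgebra.comul (R := k) (A := H)) ∘ₗ
      (headComul M (Coalgebra.comul (R := k) (A := H))).lTensor H ∘ₗ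
      (TensorProduct.assoc k H H M).toLinearMap := by
  ext h l m
  simp only [TensorProduct.AlgebraTensorModule.curry_apply, TensorProduct.curry_apply,
    LinearMap.coe_restrictScalars, LinearMap.comp_apply, LinearMap.rTensor_tmul,
    LinearMap.lTensor_tmul, comul₂, twistedComul, TensorProduct.map_tmul, LinearEquiv.coe_coe,
    TensorProduct.assoc_tmul, headComul, mid]
  generalize Coalgebra.comul (R := k) h = t
  generalize Coalgebra.comul (R := k) l = u
  induction t with
  | zero => simp
  | add x y hx hy => simp only [map_add, TensorProduct.add_tmul, hx, hy]
  | tmul x y =>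
    induction u with
    | zero => simp
    | add x y hx hy => simp only [map_add, TensorProduct.add_tmul, TensorProduct.tmul_add, hx, hy]
    | tmul z w =>
      simp only [TensorProduct.assoc_tmul, LinearMap.lTensor_tmul, LinearMap.comp_apply,
        LinearEquiv.coe_coe, TensorProduct.assoc_symm_tmul, LinearMap.rTensor_tmul, headMap]
      generalize c (y ⊗ₜ[k] z) = v
      induction v with
      | zero => simp
      | add x y hx hy =>
        simp only [map_add, TensorProduct.add_tmul, TensorProduct.tmul_add, hx, hy]
      | tmul p q => simp

/-- On one side a strand coming from the right factor is split after the crossing, on the other side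
a strand coming from the left factor. Pulling both splittings back through `c` leaves only
coassociativity of `Δ` and the interchange law. -/
theorem comul₂_coassoc (hl : CoalgCompatLeft c) (hr : CoalgCompatRight c) :
    (TensorProduct.assoc k (H ⊗[k] H) (H ⊗[k] H) (H ⊗[k] H)).toLinearMap ∘ₗ
      (comul₂ c).rTensor (H ⊗[k] H) ∘ₗ comul₂ c = (comul₂ c).lTensor (H ⊗[k] H) ∘ₗ comul₂ c := by
  refine LinearMap.ext fun x => ?_
  refine (TensorProduct.assoc k H H ((H ⊗[k] H) ⊗[k] (H ⊗[k] H))).injective ?_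
  refine (LinearEquiv.lTensor H (LinearEquiv.lTensor H
    (TensorProduct.assoc k H H (H ⊗[k] H)))).injective ?_
  have e1 := LinearMap.congr_fun (assoc_comul₂ (c := c)) x
  have e2 := LinearMap.congr_fun (assoc_rTensor_comul₂ (c := c) (M := H ⊗[k] H)) (comul₂ c x)
  have e3 : ∀ y : (H ⊗[k] H) ⊗[k] (H ⊗[k] H),
      ((TensorProduct.assoc k H H (H ⊗[k] H)).toLinearMap.lTensor H).lTensor H
        (TensorProduct.assoc k H H _ ((comul₂ c).lTensor (H ⊗[k] H) y)) =
      (((headMap H c).lTensor H ∘ₗ headComul (H ⊗[k] H) (Coalgebra.comul (R := k) (A := H)) ∘ₗ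
        (Coalgebra.comul (R := k) (A := H)).lTensor H).lTensor H).lTensor H
          (TensorProduct.assoc k H H _ y) := by
    intro y
    rw [← assoc_comul₂]
    induction y with
    | zero => simp
    | add x y hx hy => simp only [map_add, hx, hy]
    | tmul u v =>
      induction u with
      | zero => simp
      | add x y hx hy => simp only [map_add, TensorProduct.add_tmul, hx, hy]
      | tmul a b => simp
  have e4 : headComul H (Coalgebra.comul (R := k) (A := H)) ∘ₗ Coalgebra.comul =
      (Coalgebra.comul (R := k) (A := H)).lTensor H ∘ₗ Coalgebra.comul := Coalgebra.coassoc
  simp only [LinearMap.comp_apply, LinearEquiv.coe_coe] at e1 e2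
  change ((TensorProduct.assoc k H H (H ⊗[k] H)).toLinearMap.lTensor H).lTensor H _ =
    ((TensorProduct.assoc k H H (H ⊗[k] H)).toLinearMap.lTensor H).lTensor H _
  simp only [LinearMap.comp_apply, LinearEquiv.coe_coe]
  rw [e2, e3, e1]
  simp only [← LinearMap.comp_apply]
  congr 1
  simp only [LinearMap.lTensor_comp]
  have a1 := congrArg (LinearMap.lTensor H) (headComul_comp_braid (M := H) hr)
  have a2 := congrArg (LinearMap.lTensor H) (comul_lTensor_comp_braid (M := H ⊗[k] H) hl)
  have a3 := congrArg (LinearMap.lTensor H) e4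
  have a4 := congrArg (LinearMap.lTensor H)
    (headMap_natural c (Coalgebra.comul (R := k) (A := H)))
  have a5 := congrArg (LinearMap.lTensor H) (headMap_natural c (headMap H c))
  have b6 := LinearMap.congr_fun
    (headComul_coassoc (k := k) (H := H) (M := H ⊗[k] (H ⊗[k] H)))
  simp only [LinearMap.lTensor_comp] at a1 a2 a3 a4 a5
  refine LinearMap.ext fun x => ?_
  have b1 := LinearMap.congr_fun a1
  have b2 := LinearMap.congr_fun a2
  have b3 := LinearMap.congr_fun a3
  have b4 := LinearMap.congr_fun a4
  have b5 := LinearMap.congr_fun a5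
  simp only [LinearMap.comp_apply] at b1 b2 b3 b4 b5 b6 ⊢
  rw [b1, ← headComul_lTensor _ (headComul H _), b3, headComul_lTensor, headComul_lTensor, b5,
    ← b4, b2, ← headComul_lTensor _ (LinearMap.lTensor H _), ← b6]

/-- The second of the two counits meets the strand that came from `u` across `c`, and compatibility
of `c` with `ε` undoes the crossing. -/
theorem counit₂_rTensor_mid (hr : CoalgCompatRight c) (t u : H ⊗[k] H) :
    (counit₂ k H).rTensor (H ⊗[k] H) (mid H H c (t ⊗ₜ[k] u)) =
      1 ⊗ₜ[k] (TensorProduct.lid k H (Coalgebra.counit.rTensor H t) ⊗ₜ[k]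
        TensorProduct.lid k H (Coalgebra.counit.rTensor H u)) := by
  induction t with
  | zero => simp
  | add x y hx hy => simp only [map_add, TensorProduct.add_tmul, TensorProduct.tmul_add, hx, hy]
  | tmul x y =>
    induction u with
    | zero => simp
    | add x y hx hy => simp only [map_add, TensorProduct.tmul_add, hx, hy]
    | tmul z w =>
      have key : ∀ v : H ⊗[k] H, (counit₂ k H).rTensor (H ⊗[k] H)
          ((TensorProduct.assoc k H H (H ⊗[k] H)).symm
            (x ⊗ₜ[k] TensorProduct.assoc k H H H (v ⊗ₜ[k] w))) =
          1 ⊗ₜ[k] ((Coalgebra.counit (R := k) x • TensorProduct.lid k H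
            (Coalgebra.counit.rTensor H v)) ⊗ₜ[k] w) := by
        intro v
        induction v with
        | zero => simp
        | add x y hx hy =>
          simp only [map_add, TensorProduct.add_tmul, TensorProduct.tmul_add, smul_add, hx, hy]
        | tmul p q =>
          simp only [TensorProduct.assoc_tmul, TensorProduct.assoc_symm_tmul,
            LinearMap.rTensor_tmul, counit₂, LinearMap.comp_apply, TensorProduct.map_tmul,
            LinearMap.mul'_apply, TensorProduct.lid_tmul, smul_smul]
          rw [← TensorProduct.smul_tmul', TensorProduct.tmul_smul, ← smul_eq_mul,
            TensorProduct.smul_tmul', smul_eq_mul, smul_eq_mul, mul_one]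
      have h := LinearMap.congr_fun hr.counit (y ⊗ₜ[k] z)
      simp only [LinearMap.comp_apply, LinearEquiv.coe_coe] at h
      simp only [mid, LinearMap.comp_apply, LinearEquiv.coe_coe, TensorProduct.assoc_tmul,
        LinearMap.lTensor_tmul, TensorProduct.assoc_symm_tmul, LinearMap.rTensor_tmul]
      rw [key, h]
      simp [TensorProduct.smul_tmul', TensorProduct.tmul_smul, smul_smul, mul_comm]

theorem counit₂_lTensor_mid (hl : CoalgCompatLeft c) (t u : H ⊗[k] H) :
    (counit₂ k H).lTensor (H ⊗[k] H) (mid H H c (t ⊗ₜ[k] u)) =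
      (TensorProduct.rid k H (Coalgebra.counit.lTensor H t) ⊗ₜ[k]
        TensorProduct.rid k H (Coalgebra.counit.lTensor H u)) ⊗ₜ[k] 1 := by
  induction t with
  | zero => simp
  | add x y hx hy => simp only [map_add, TensorProduct.add_tmul, hx, hy]
  | tmul x y =>
    induction u with
    | zero => simp
    | add x y hx hy => simp only [map_add, TensorProduct.tmul_add, TensorProduct.add_tmul, hx, hy]
    | tmul z w =>
      have key : ∀ v : H ⊗[k] H, (counit₂ k H).lTensor (H ⊗[k] H)
          ((TensorProduct.assoc k H H (H ⊗[k] H)).symm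
            (x ⊗ₜ[k] TensorProduct.assoc k H H H (v ⊗ₜ[k] w))) =
          (x ⊗ₜ[k] (Coalgebra.counit (R := k) w • TensorProduct.rid k H
            (Coalgebra.counit.lTensor H v))) ⊗ₜ[k] 1 := by
        intro v
        induction v with
        | zero => simp
        | add x y hx hy =>
          simp only [map_add, TensorProduct.add_tmul, TensorProduct.tmul_add, smul_add, hx, hy]
        | tmul p q =>
          simp only [TensorProduct.assoc_tmul, TensorProduct.assoc_symm_tmul,
            LinearMap.lTensor_tmul, counit₂, LinearMap.comp_apply, TensorProduct.map_tmul,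
            LinearMap.mul'_apply, TensorProduct.rid_tmul, smul_smul]
          rw [TensorProduct.tmul_smul, TensorProduct.smul_tmul, smul_eq_mul, mul_one, mul_comm]
      have h := LinearMap.congr_fun hl.counit (y ⊗ₜ[k] z)
      simp only [LinearMap.comp_apply, LinearEquiv.coe_coe] at h
      simp only [mid, LinearMap.comp_apply, LinearEquiv.coe_coe, TensorProduct.assoc_tmul,
        LinearMap.lTensor_tmul, TensorProduct.assoc_symm_tmul, LinearMap.rTensor_tmul]
      rw [key, h]
      simp [TensorProduct.smul_tmul', TensorProduct.tmul_smul, smul_smul, mul_comm]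

theorem isCoalg_comul₂ (hl : CoalgCompatLeft c) (hr : CoalgCompatRight c) :
    IsCoalg (comul₂ c) (counit₂ k H) where
  coassoc := comul₂_coassoc hl hr
  rTensor_counit x := by
    induction x with
    | zero => simp
    | add x y hx hy => simp only [map_add, TensorProduct.tmul_add, hx, hy]
    | tmul h l =>
      simp only [comul₂, twistedComul, LinearMap.comp_apply, TensorProduct.map_tmul]
      rw [counit₂_rTensor_mid hr]
      simp
  lTensor_counit x := by
    induction x with
    | zero => simp
    | add x y hx hy => simp only [map_add, TensorProduct.add_tmul, hx, hy]
    | tmul h l =>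
      simp only [comul₂, twistedComul, LinearMap.comp_apply, TensorProduct.map_tmul]
      rw [counit₂_lTensor_mid hl]
      simp

end Comul

/-! ### Naturality of sliding a strand -/

section Natural

variable {k : Type*} [Field k]
  {V W X Y X' Y' : Type*}
  [AddCommGroup V] [Module k V] [AddCommGroup W] [Module k W]
  [AddCommGroup X] [Module k X] [AddCommGroup Y] [Module k Y]
  [AddCommGroup X'] [Module k X'] [AddCommGroup Y'] [Module k Y']

theorem rTensor_tmul_right_eq {s : V ⊗[k] X →ₗ[k] X ⊗[k] V} {s' : V ⊗[k] X' →ₗ[k] X' ⊗[k] V}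
    {f : X →ₗ[k] X'} (hf : f.rTensor V ∘ₗ s = s' ∘ₗ f.lTensor V) (v : V) (x : X) :
    s' (v ⊗ₜ[k] f x) = f.rTensor V (s (v ⊗ₜ[k] x)) :=
  (LinearMap.congr_fun hf (v ⊗ₜ[k] x)).symm

theorem slideL_natural {s : V ⊗[k] X →ₗ[k] X ⊗[k] V} {s' : V ⊗[k] X' →ₗ[k] X' ⊗[k] V}
    {t : W ⊗[k] X →ₗ[k] X ⊗[k] W} {t' : W ⊗[k] X' →ₗ[k] X' ⊗[k] W}
    {f : X →ₗ[k] X'} (hs : f.rTensor V ∘ₗ s = s' ∘ₗ f.lTensor V)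
    (ht : f.rTensor W ∘ₗ t = t' ∘ₗ f.lTensor W) :
    f.rTensor (V ⊗[k] W) ∘ₗ slideL s t = slideL s' t' ∘ₗ f.lTensor (V ⊗[k] W) := by
  ext v w x
  simp only [TensorProduct.AlgebraTensorModule.curry_apply, TensorProduct.curry_apply,
    LinearMap.coe_restrictScalars, slideL, LinearMap.comp_apply, LinearEquiv.coe_coe,
    LinearMap.lTensor_tmul, TensorProduct.assoc_tmul, rTensor_tmul_right_eq ht]
  generalize t (w ⊗ₜ[k] x) = u
  induction u with
  | zero => simp
  | add x y hx hy => simp only [map_add, TensorProduct.tmul_add, hx, hy]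
  | tmul x w =>
    simp only [TensorProduct.assoc_symm_tmul, LinearMap.rTensor_tmul, rTensor_tmul_right_eq hs]
    generalize s (v ⊗ₜ[k] x) = u
    induction u with
    | zero => simp
    | add x y hx hy => simp only [map_add, TensorProduct.add_tmul, hx, hy]
    | tmul x w => simp

theorem slideR_natural {s : V ⊗[k] X →ₗ[k] X ⊗[k] V} {s' : V ⊗[k] X' →ₗ[k] X' ⊗[k] V}
    {t : V ⊗[k] Y →ₗ[k] Y ⊗[k] V} {t' : V ⊗[k] Y' →ₗ[k] Y' ⊗[k] V}
    {f : X →ₗ[k] X'} {g : Y →ₗ[k] Y'} (hs : f.rTensor V ∘ₗ s = s' ∘ₗ f.lTensor V)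
    (ht : g.rTensor V ∘ₗ t = t' ∘ₗ g.lTensor V) :
    (TensorProduct.map f g).rTensor V ∘ₗ slideR s t =
      slideR s' t' ∘ₗ (TensorProduct.map f g).lTensor V := by
  ext v x y
  simp only [TensorProduct.AlgebraTensorModule.curry_apply, TensorProduct.curry_apply,
    LinearMap.coe_restrictScalars, slideR, LinearMap.comp_apply, LinearEquiv.coe_coe,
    LinearMap.lTensor_tmul, TensorProduct.assoc_symm_tmul, TensorProduct.map_tmul,
    LinearMap.rTensor_tmul, rTensor_tmul_right_eq hs]
  generalize s (v ⊗ₜ[k] x) = u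
  induction u with
  | zero => simp
  | add x y hx hy => simp only [map_add, TensorProduct.add_tmul, hx, hy]
  | tmul x w =>
    simp only [TensorProduct.assoc_tmul, LinearMap.lTensor_tmul, LinearMap.rTensor_tmul,
      rTensor_tmul_right_eq ht]
    generalize t (w ⊗ₜ[k] y) = u
    induction u with
    | zero => simp
    | add x y hx hy => simp only [map_add, TensorProduct.tmul_add, hx, hy]
    | tmul x w => simp

theorem rTensor_lTensor_comm (f : X →ₗ[k] X') (g : V →ₗ[k] W) (t : X ⊗[k] V) :
    f.rTensor W (g.lTensor X t) = g.lTensor X' (f.rTensor V t) := by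
  induction t with
  | zero => simp
  | add x y hx hy => simp only [map_add, hx, hy]
  | tmul x y => simp

end Natural

/-! ### The induced transposition on the coinvariants -/

section Induced

variable {k : Type*} [Field k] {H : Type*} [Ring H] [Algebra k H] [Coalgebra k H]
  {A : Type*} [Ring A] [Algebra k A] {B : Type*} [Ring B] [Algebra k B]
  {c : H ⊗[k] H →ₗ[k] H ⊗[k] H} {s : H ⊗[k] B →ₗ[k] B ⊗[k] H}
  {ν : B →ₗ[k] B ⊗[k] H} {i : A →ₐ[k] B}

theorem slideR_bijective (hc : Function.Bijective c) (hs : Function.Bijective s) :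
    Function.Bijective (slideR s c) := by
  have h1 := (LinearEquiv.lTensor B (LinearEquiv.ofBijective c hc)).bijective
  have h2 := (LinearEquiv.rTensor H (LinearEquiv.ofBijective s hs)).bijective
  exact (TensorProduct.assoc k B H H).symm.bijective.comp (h1.comp
    ((TensorProduct.assoc k B H H).bijective.comp (h2.comp
      (TensorProduct.assoc k H B H).symm.bijective)))

/-- Over a field this exactness survives tensoring with `H`, which gives a test for membership in `H
⊗ i(A)`. -/
theorem coinvariant_exact (hE : IsExtension c s ν i) :
    Function.Exact i.toLinearMap (ν - (TensorProduct.mk k B H).flip 1) := by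
  intro b
  rw [LinearMap.sub_apply, sub_eq_zero]
  exact (hE.range_eq b).symm

/-- Injectivity is inherited from `s`. For surjectivity, the preimage under `s` of an element of
`i(A) ⊗ H` must be shown to lie in `H ⊗ i(A)`. -/
theorem induced_bijective (hH : IsBraidedBialgebra c) (hE : IsExtension c s ν i) :
    Function.Bijective (induced hH hE) := by
  have hs := hE.comoduleAlgebra.transposition.bijective
  have hspec := fun x => LinearMap.congr_fun (induced_spec hH hE) x
  simp only [LinearMap.comp_apply] at hspec
  have hinj : Function.Injective (i.toLinearMap.lTensor H) :=
    Module.Flat.lTensor_preserves_injective_linearMap _ hE.injective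
  constructor
  · intro x y hxy
    apply hinj
    apply hs.1
    rw [← hspec, ← hspec, hxy]
  · intro y
    obtain ⟨x, hx⟩ := hs.2 (i.toLinearMap.rTensor H y)
    have hex := Module.Flat.lTensor_exact H (coinvariant_exact hE)
    -- Moving `h` past `B ⊗ H` intertwines `H ⊗ (ν - (- ⊗ 1))` with `(ν - (- ⊗ 1)) ⊗ H`, and it is
    -- injective, so vanishing can be checked after applying `s`.
    have hx0 : (ν - (TensorProduct.mk k B H).flip 1).lTensor H x = 0 := by
      apply (slideR_bijective hH.bijective hs).1
      have h1 := LinearMap.congr_fun hE.comoduleAlgebra.braided x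
      have h2 : ∀ x : H ⊗[k] B, slideR s c (((TensorProduct.mk k B H).flip 1).lTensor H x) =
          ((TensorProduct.mk k B H).flip 1).rTensor H (s x) := by
        intro x
        induction x with
        | zero => simp
        | add x y hx hy => simp only [map_add, hx, hy]
        | tmul h b => exact slideR_coinvariant hH h b
      simp only [LinearMap.comp_apply] at h1
      rw [LinearMap.lTensor_sub, LinearMap.sub_apply, map_sub, ← h1, h2, map_zero, hx,
        ← LinearMap.sub_apply, ← LinearMap.rTensor_sub, ← LinearMap.comp_apply,
        ← LinearMap.rTensor_comp]
      have : (ν - (TensorProduct.mk k B H).flip 1) ∘ₗ i.toLinearMap = 0 :=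
        (coinvariant_exact hE).linearMap_comp_eq_zero
      rw [this]
      simp
    obtain ⟨z, rfl⟩ := (hex x).1 hx0
    exact ⟨z, rTensor_injective hE (by rw [hspec, hx])⟩

/-- Apart from bijectivity, each axiom is the one for `s`, pulled back along an injective map
induced by `i`. -/
theorem induced_isTransposition (hH : IsBraidedBialgebra c) (hE : IsExtension c s ν i) :
    IsTransposition c (induced hH hE) := by
  have hs := hE.comoduleAlgebra.transposition
  have hspec := induced_spec hH hE
  have hspec' := fun x => LinearMap.congr_fun hspec x
  simp only [LinearMap.comp_apply] at hspec'
  have hL := fun x => LinearMap.congr_fun (slideL_natural hspec hspec) x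
  simp only [LinearMap.comp_apply] at hL
  have hinj2 : Function.Injective (i.toLinearMap.rTensor (H ⊗[k] H)) :=
    Module.Flat.rTensor_preserves_injective_linearMap _ hE.injective
  refine ⟨⟨induced_bijective hH hE, ⟨fun a => ?_, ?_⟩, ⟨?_, ?_⟩, ?_⟩, ⟨fun h => ?_, ?_⟩⟩
  · apply rTensor_injective hE
    rw [hspec']
    simp [hs.alg.unit]
  · refine LinearMap.ext fun x => rTensor_injective hE ?_
    have := LinearMap.congr_fun hs.alg.mul (i.toLinearMap.lTensor (H ⊗[k] H) x)
    simp only [LinearMap.comp_apply] at this ⊢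
    rw [hspec', ← rTensor_lTensor_comm, this, rTensor_lTensor_comm, hL]
  · refine LinearMap.ext fun x => hE.injective ?_
    have := LinearMap.congr_fun hs.coalg.counit (i.toLinearMap.lTensor H x)
    simp only [LinearMap.comp_apply, LinearEquiv.coe_coe] at this ⊢
    rw [← hspec', ← rTensor_lTensor_comm, rTensor_lTensor_comm] at this
    have e1 : ∀ y : A ⊗[k] k, TensorProduct.rid k B (i.toLinearMap.rTensor k y) =
      i (TensorProduct.rid k A y) := by
      intro y
      induction y with
      | zero => simp
      | add x y hx hy => simp only [map_add, hx, hy]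
      | tmul a r => simp
    have e2 : ∀ y : k ⊗[k] A, TensorProduct.lid k B (i.toLinearMap.lTensor k y) =
      i (TensorProduct.lid k A y) := by
      intro y
      induction y with
      | zero => simp
      | add x y hx hy => simp only [map_add, hx, hy]
      | tmul a r => simp
    rw [← e1, ← e2, rTensor_lTensor_comm, this, rTensor_lTensor_comm]
  · refine LinearMap.ext fun x => hinj2 ?_
    have := LinearMap.congr_fun hs.coalg.comul (i.toLinearMap.lTensor H x)
    simp only [LinearMap.comp_apply] at this ⊢
    rw [rTensor_lTensor_comm, hspec', this, hL, rTensor_lTensor_comm]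
  · refine LinearMap.ext fun x => hinj2 ?_
    have := LinearMap.congr_fun hs.braid (i.toLinearMap.lTensor (H ⊗[k] H) x)
    simp only [LinearMap.comp_apply] at this ⊢
    rw [hL, ← rTensor_lTensor_comm, this, rTensor_lTensor_comm, hL]
  · apply rTensor_injective hE
    rw [hspec']
    simp [hs.algRight.unit]
  · refine LinearMap.ext fun x => rTensor_injective hE ?_
    have := LinearMap.congr_fun hs.algRight.mul
      ((TensorProduct.map i.toLinearMap i.toLinearMap).lTensor H x)
    have hR := fun x => LinearMap.congr_fun (slideR_natural hspec hspec) x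
    have hm : i.toLinearMap ∘ₗ LinearMap.mul' k A =
        LinearMap.mul' k B ∘ₗ TensorProduct.map i.toLinearMap i.toLinearMap := by
      ext; simp
    simp only [LinearMap.comp_apply] at this hR ⊢
    rw [hspec', ← LinearMap.lTensor_comp_apply, hm, LinearMap.lTensor_comp_apply, this, ← hR,
      ← LinearMap.rTensor_comp_apply, ← LinearMap.rTensor_comp_apply, hm]

end Induced

/-! ### Cleft maps, coinvariants and the resulting normal basis -/

section Cleft

variable {k : Type*} [Field k] {H : Type*} [Ring H] [Algebra k H] [Coalgebra k H]
  {A : Type*} [Ring A] [Algebra k A] {B : Type*} [Ring B] [Algebra k B]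
  {c : H ⊗[k] H →ₗ[k] H ⊗[k] H} {s : H ⊗[k] B →ₗ[k] B ⊗[k] H}
  {ν : B →ₗ[k] B ⊗[k] H} {i : A →ₐ[k] B} {γ γ' : H →ₗ[k] B}

theorem twistedMul_smul (b : B) (t u : B ⊗[k] H) :
    twistedMul s ((b • t) ⊗ₜ[k] u) = b • twistedMul s (t ⊗ₜ[k] u) := by
  induction t with
  | zero => simp
  | add x y hx hy => simp only [smul_add, TensorProduct.add_tmul, map_add, hx, hy]
  | tmul x h =>
    induction u with
    | zero => simp
    | add x y hx hy => simp only [TensorProduct.tmul_add, map_add, smul_add, hx, hy]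
    | tmul y l =>
      simp only [TensorProduct.smul_tmul', twistedMul, mid, LinearMap.comp_apply,
        LinearEquiv.coe_coe, TensorProduct.assoc_tmul, LinearMap.lTensor_tmul,
        TensorProduct.assoc_symm_tmul, LinearMap.rTensor_tmul]
      generalize s (h ⊗ₜ[k] y) = v
      induction v with
      | zero => simp
      | add x y hx hy =>
        simp only [TensorProduct.tmul_add, TensorProduct.add_tmul, map_add, smul_add, hx, hy]
      | tmul p q => simp [TensorProduct.smul_tmul', mul_assoc]

theorem IsExtension.coaction_mul (hE : IsExtension c s ν i) (x y : B) :
    ν (x * y) = twistedMul s (ν x ⊗ₜ[k] ν y) := by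
  simpa using LinearMap.congr_fun hE.comoduleAlgebra.map_mul (x ⊗ₜ[k] y)

theorem IsExtension.coaction_i (hE : IsExtension c s ν i) (a : A) : ν (i a) = i a ⊗ₜ[k] 1 :=
  (hE.range_eq _).1 ⟨a, rfl⟩

theorem IsExtension.coaction_i_mul (hE : IsExtension c s ν i) (a : A) (y : B) :
    ν (i a * y) = i a • ν y := by
  rw [hE.coaction_mul, hE.coaction_i, twistedMul_one_left hE.comoduleAlgebra]

theorem IsCleftMap.coaction (hγ : IsCleftMap c s ν γ γ') (h : H) :
    ν (γ h) = γ.rTensor H (Coalgebra.comul (R := k) h) :=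
  LinearMap.congr_fun hγ.colinear h

/-- `(1 ⊗ h₁) ν(γ'(h₂)) = γ'(h) ⊗ 1`. -/
theorem IsCleftMap.coaction_inverse (hE : IsExtension c s ν i) (hγ : IsCleftMap c s ν γ γ')
    (h : H) : twistedMul s (TensorProduct.map (TensorProduct.mk k B H 1) (ν ∘ₗ γ')
      (Coalgebra.comul (R := k) h)) = γ' h ⊗ₜ[k] 1 := by
  have hC := isCoalg_comul (k := k) H
  -- Rather than computing `ν ∘ γ'`, show that `γ(h₁) • N(h₂) = ν(γ(h₁) γ'(h₂)) = ε(h) 1 ⊗ 1` and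
  -- then cancel `γ`.
  let N : H →ₗ[k] B ⊗[k] H := twistedMul s ∘ₗ
    TensorProduct.map (TensorProduct.mk k B H 1) (ν ∘ₗ γ') ∘ₗ Coalgebra.comul
  have h1 : ∀ h, actMap N (γ.rTensor H (Coalgebra.comul (R := k) h)) =
      Coalgebra.counit (R := k) h • ((1 : B) ⊗ₜ[k] (1 : H)) := by
    intro h
    have e1 : ∀ t : H ⊗[k] H, actMap N (γ.rTensor H t) =
        twistedMul s (TensorProduct.map (γ.rTensor H) (ν ∘ₗ γ')
          ((TensorProduct.assoc k H H H).symm (Coalgebra.comul.lTensor H t))) := by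
      intro t
      induction t with
      | zero => simp
      | add x y hx hy => simp only [map_add, hx, hy]
      | tmul x y =>
        simp only [LinearMap.rTensor_tmul, actMap_tmul, LinearMap.lTensor_tmul, N,
          LinearMap.comp_apply]
        generalize Coalgebra.comul (R := k) y = u
        induction u with
        | zero => simp
        | add x y hx hy => simp only [map_add, smul_add, TensorProduct.tmul_add, hx, hy]
        | tmul y z =>
          simp [← twistedMul_smul, TensorProduct.smul_tmul']
    rw [e1, ← Coalgebra.coassoc_apply, LinearEquiv.symm_apply_apply]
    have e2 : ∀ t : H ⊗[k] H, twistedMul s (TensorProduct.map (γ.rTensor H) (ν ∘ₗ γ')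
        (Coalgebra.comul.rTensor H t)) =
        ν (LinearMap.mul' k B (TensorProduct.map γ γ' t)) := by
      intro t
      induction t with
      | zero => simp
      | add x y hx hy => simp only [map_add, hx, hy]
      | tmul x y => simp [hE.coaction_mul, hγ.coaction]
    have e3 := LinearMap.congr_fun hγ.inverse.mul_right h
    simp only [LinearMap.comp_apply, Algebra.linearMap_apply, Algebra.algebraMap_eq_smul_one]
      at e3
    rw [e2, e3, map_smul, hE.comoduleAlgebra.map_one]
  have h2 : ∀ t : B ⊗[k] H, actMap N (spread Coalgebra.comul γ t) =
      TensorProduct.rid k B (Coalgebra.counit.lTensor B t) ⊗ₜ[k] (1 : H) := by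
    intro t
    induction t with
    | zero => simp
    | add x y hx hy => simp only [map_add, TensorProduct.add_tmul, hx, hy]
    | tmul b h =>
      rw [spread_tmul, actMap_smul, h1]
      simp [TensorProduct.smul_tmul']
  -- The cancellation: the spread of `γ` sends `γ'(h₁) ⊗ h₂` to `1 ⊗ h`, so the left side becomes
  -- `N(h)`.
  have h3 := h2 (γ'.rTensor H (Coalgebra.comul (R := k) h))
  rw [spread_rTensor hC, hγ.inverse.mul_left, rTensor_unit_counit hC,
    rid_lTensor_counit_rTensor hC, actMap_tmul, one_smul] at h3
  exact h3

/-- The map `b ↦ b₀ γ'(b₁)` takes values in the coinvariants. -/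
theorem IsCleftMap.coinvariant (hE : IsExtension c s ν i) (hγ : IsCleftMap c s ν γ γ') (b : B) :
    LinearMap.mul' k B (γ'.lTensor B (ν b)) ∈ Set.range i := by
  rw [hE.range_eq]
  -- Multiplicativity of `ν` gives `ν(b₀) ν(γ'(b₁))`; coassociativity regroups it as `b₀ • (1 ⊗ b₁)
  -- ν(γ'(b₂))`, where `coaction_inverse` applies.
  have e1 : ∀ t : B ⊗[k] H, ν (LinearMap.mul' k B (γ'.lTensor B t)) =
      twistedMul s (TensorProduct.map LinearMap.id (ν ∘ₗ γ') (ν.rTensor H t)) := by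
    intro t
    induction t with
    | zero => simp
    | add x y hx hy => simp only [map_add, hx, hy]
    | tmul x y => simp [hE.coaction_mul]
  have e2 : ∀ t : B ⊗[k] H, twistedMul s (TensorProduct.map LinearMap.id (ν ∘ₗ γ')
      ((TensorProduct.assoc k B H H).symm (Coalgebra.comul.lTensor B t))) =
      LinearMap.mul' k B (γ'.lTensor B t) ⊗ₜ[k] 1 := by
    intro t
    induction t with
    | zero => simp
    | add x y hx hy => simp only [map_add, TensorProduct.add_tmul, hx, hy]
    | tmul b h =>
      have := congrArg (b • ·) (hγ.coaction_inverse hE h)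
      simp only [TensorProduct.smul_tmul', smul_eq_mul] at this
      simp only [LinearMap.lTensor_tmul, LinearMap.mul'_apply]
      rw [← this]
      generalize Coalgebra.comul (R := k) h = u
      induction u with
      | zero => simp
      | add x y hx hy => simp only [map_add, smul_add, TensorProduct.tmul_add, hx, hy]
      | tmul x y => simp [← twistedMul_smul, TensorProduct.smul_tmul']
  have e3 := LinearMap.congr_fun hE.comoduleAlgebra.coaction.coassoc b
  simp only [LinearMap.comp_apply, LinearEquiv.coe_coe] at e3
  rw [e1, ← e2, ← e3, LinearEquiv.symm_apply_apply]

/-- `a ⊗ h ↦ i(a) γ(h)`. -/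
def basisMap (i : A →ₐ[k] B) (γ : H →ₗ[k] B) : A ⊗[k] H →ₗ[k] B :=
  LinearMap.mul' k B ∘ₗ TensorProduct.map i.toLinearMap γ

theorem basisMap_tmul (a : A) (h : H) : basisMap i γ (a ⊗ₜ[k] h) = i a * γ h := rfl

theorem basisMap_smul (a : A) (t : A ⊗[k] H) : basisMap i γ (a • t) = i a * basisMap i γ t := by
  induction t with
  | zero => simp
  | add x y hx hy => simp only [smul_add, map_add, mul_add, hx, hy]
  | tmul x h => simp [basisMap_tmul, TensorProduct.smul_tmul', mul_assoc]

/-- Let `E : B → A` be defined by `i(E(b)) = b₀ γ'(b₁)`. It is left `A`-linear with `E(γ(h)) =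
ε(h)1`, and `b ↦ E(b₀) ⊗ b₁` is the inverse: one composite uses these two properties, the other uses
`γ'(h₁) γ(h₂) = ε(h)1`. -/
theorem IsCleftMap.basisMap_bijective (hE : IsExtension c s ν i) (hγ : IsCleftMap c s ν γ γ') :
    Function.Bijective (basisMap i γ) := by
  have hC := isCoalg_comul (k := k) H
  choose E hEi using hγ.coinvariant hE
  have Eadd : ∀ x y, E (x + y) = E x + E y := fun x y => hE.injective (by
    simp only [map_add, hEi])
  have Esmul : ∀ (r : k) x, E (r • x) = r • E x := fun r x => hE.injective (by
    simp only [map_smul, hEi])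
  let EA : B →ₗ[k] A := ⟨⟨E, Eadd⟩, Esmul⟩
  have hEA : ∀ b, i (EA b) = LinearMap.mul' k B (γ'.lTensor B (ν b)) := hEi
  have hEA_mul : ∀ a b, EA (i a * b) = a * EA b := by
    intro a b
    apply hE.injective
    rw [map_mul i, hEA, hEA, hE.coaction_i_mul]
    generalize ν b = t
    induction t with
    | zero => simp
    | add x y hx hy => simp only [map_add, smul_add, mul_add, hx, hy]
    | tmul x h => simp [TensorProduct.smul_tmul', mul_assoc]
  have hEA_γ : ∀ h, EA (γ h) = Algebra.linearMap k A (Coalgebra.counit h) := by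
    intro h
    apply hE.injective
    rw [hEA, hγ.coaction]
    have := LinearMap.congr_fun hγ.inverse.mul_right h
    simp only [LinearMap.comp_apply] at this
    rw [← LinearMap.comp_apply (γ'.lTensor B), LinearMap.lTensor_comp_rTensor, this]
    simp
  refine Function.bijective_iff_has_inverse.2 ⟨fun b => EA.rTensor H (ν b), fun t => ?_,
    fun b => ?_⟩
  · dsimp only
    induction t with
    | zero => simp
    | add x y hx hy => simp only [map_add, hx, hy]
    | tmul a h =>
      rw [basisMap_tmul, hE.coaction_i_mul, hγ.coaction]
      have : ∀ u : H ⊗[k] H, EA.rTensor H (i a • γ.rTensor H u) =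
          a • (Algebra.linearMap k A ∘ₗ Coalgebra.counit).rTensor H u := by
        intro u
        induction u with
        | zero => simp
        | add x y hx hy => simp only [map_add, smul_add, hx, hy]
        | tmul x y => simp [TensorProduct.smul_tmul', hEA_mul, hEA_γ]
      rw [this, rTensor_unit_counit hC]
      simp [TensorProduct.smul_tmul']
  · have e1 : ∀ t : B ⊗[k] H, basisMap i γ (EA.rTensor H t) =
        LinearMap.mul' k B (TensorProduct.map (LinearMap.mul' k B ∘ₗ γ'.lTensor B) γ
          (ν.rTensor H t)) := by
      intro t
      induction t with
      | zero => simp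
      | add x y hx hy => simp only [map_add, hx, hy]
      | tmul x y => simp [basisMap_tmul, hEA]
    have e2 : ∀ t : B ⊗[k] H, LinearMap.mul' k B (TensorProduct.map
        (LinearMap.mul' k B ∘ₗ γ'.lTensor B) γ
          ((TensorProduct.assoc k B H H).symm (Coalgebra.comul.lTensor B t))) =
        TensorProduct.rid k B (Coalgebra.counit.lTensor B t) := by
      intro t
      induction t with
      | zero => simp
      | add x y hx hy => simp only [map_add, hx, hy]
      | tmul b h =>
        have := congrArg (b * ·) (LinearMap.congr_fun hγ.inverse.mul_left h)
        simp only [LinearMap.comp_apply] at this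
        have e : TensorProduct.rid k B (Coalgebra.counit.lTensor B (b ⊗ₜ[k] h)) =
          b * Algebra.linearMap k B (Coalgebra.counit h) := by
            simp [Algebra.algebraMap_eq_smul_one]
        rw [e, ← this, LinearMap.lTensor_tmul]
        generalize Coalgebra.comul (R := k) h = u
        induction u with
        | zero => simp
        | add x y hx hy => simp only [map_add, mul_add, TensorProduct.tmul_add, hx, hy]
        | tmul x y => simp [mul_assoc]
    have e3 := LinearMap.congr_fun hE.comoduleAlgebra.coaction.coassoc b
    have e4 := LinearMap.congr_fun hE.comoduleAlgebra.coaction.counit b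
    simp only [LinearMap.comp_apply, LinearEquiv.coe_coe] at e3 e4
    rw [e1, ← (TensorProduct.assoc k B H H).symm_apply_apply (ν.rTensor H (ν b)), e3, e2, e4,
      LinearMap.id_apply]

theorem basisMap_colinear (hE : IsExtension c s ν i)
    (hγ : ν ∘ₗ γ = γ.rTensor H ∘ₗ Coalgebra.comul) :
    ν ∘ₗ basisMap i γ = (basisMap i γ).rTensor H ∘ₗ freeCoaction k A H := by
  ext a h
  have hγh := LinearMap.congr_fun hγ h
  simp only [LinearMap.comp_apply] at hγh
  simp only [TensorProduct.AlgebraTensorModule.curry_apply, TensorProduct.curry_apply,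
    LinearMap.coe_restrictScalars, LinearMap.comp_apply, basisMap_tmul, hE.coaction_i_mul, hγh,
    freeCoaction, LinearMap.lTensor_tmul, LinearEquiv.coe_coe]
  generalize Coalgebra.comul (R := k) h = u
  induction u with
  | zero => simp
  | add x y hx hy => simp only [map_add, smul_add, TensorProduct.tmul_add, hx, hy]
  | tmul x y => simp [basisMap_tmul, TensorProduct.smul_tmul']

/-- Compatibility of `s` with `μ_B` lets a strand pass both factors in turn. It serves for the
products `i·γ`, `γ·i` and `γ·γ`. -/
theorem mul_map_braided {V W : Type*} [AddCommGroup V] [Module k V] [AddCommGroup W] [Module k W]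
    {t : H ⊗[k] V →ₗ[k] V ⊗[k] H} {u : H ⊗[k] W →ₗ[k] W ⊗[k] H} {f : V →ₗ[k] B} {g : W →ₗ[k] B}
    (hs : AlgCompatRight s) (hf : f.rTensor H ∘ₗ t = s ∘ₗ f.lTensor H)
    (hg : g.rTensor H ∘ₗ u = s ∘ₗ g.lTensor H) :
    (LinearMap.mul' k B ∘ₗ TensorProduct.map f g).rTensor H ∘ₗ slideR t u =
      s ∘ₗ (LinearMap.mul' k B ∘ₗ TensorProduct.map f g).lTensor H := by
  rw [LinearMap.rTensor_comp, LinearMap.comp_assoc, slideR_natural hf hg, LinearMap.lTensor_comp,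
    ← LinearMap.comp_assoc, ← LinearMap.comp_assoc, hs.mul]

theorem IsCleftMap.exists_isNormalBasis (hH : IsBraidedBialgebra c) (hE : IsExtension c s ν i)
    (hγ : IsCleftMap c s ν γ γ') :
    ∃ φ : A ⊗[k] H ≃ₗ[k] B, (∀ (a : A) (h : H), φ (a ⊗ₜ[k] h) = i a * γ h) ∧
      IsNormalBasis c s ν i (induced hH hE) φ := by
  refine ⟨LinearEquiv.ofBijective (basisMap i γ) (hγ.basisMap_bijective hE), fun a h => rfl,
    basisMap_smul, basisMap_colinear hE hγ.colinear, ?_⟩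
  exact mul_map_braided hE.comoduleAlgebra.transposition.algRight (induced_spec hH hE) hγ.braided

/-- A cleft map can be normalized. -/
theorem IsCleftMap.exists_normalized (hH : IsBraidedBialgebra c) (hE : IsExtension c s ν i)
    (hγ : IsCleftMap c s ν γ γ') :
    ∃ δ δ' : H →ₗ[k] B, IsCleftMap c s ν δ δ' ∧ δ 1 = 1 := by
  have hs := hE.comoduleAlgebra.transposition
  have h1 : γ 1 * γ' 1 = 1 := by
    simpa [hH.comul_one, hH.counit_one] using LinearMap.congr_fun hγ.inverse.mul_right 1
  have h2 : γ' 1 * γ 1 = 1 := by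
    simpa [hH.comul_one, hH.counit_one] using LinearMap.congr_fun hγ.inverse.mul_left 1
  have hν : ν (γ 1) = γ 1 ⊗ₜ[k] 1 := by
    simpa [hH.comul_one] using hγ.coaction 1
  obtain ⟨a, ha⟩ := (hE.range_eq _).2 hν
  have hν' : ν (γ' 1) = γ' 1 ⊗ₜ[k] 1 := by
    have := hE.coaction_i_mul a (γ' 1)
    rw [ha, h1, hE.comoduleAlgebra.map_one] at this
    have := congrArg (γ' 1 • ·) this
    simpa [smul_smul, h2, TensorProduct.smul_tmul'] using this.symm
  obtain ⟨a', ha'⟩ := (hE.range_eq _).2 hν'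
  -- Because `c(h ⊗ 1) = 1 ⊗ h`, the unit `γ(1)` of `B` is transparent to `s`; hence so is its
  -- inverse `γ'(1)`.
  have hsγ : ∀ h, s (h ⊗ₜ[k] γ 1) = γ 1 ⊗ₜ[k] h := fun h => by
    simpa [hH.algRight.unit] using (LinearMap.congr_fun hγ.braided (h ⊗ₜ[k] 1)).symm
  have hmul : ∀ (h : H) (u x : B), s (h ⊗ₜ[k] u) = u ⊗ₜ[k] h →
      s (h ⊗ₜ[k] (u * x)) = u • s (h ⊗ₜ[k] x) := by
    intro h u x hu
    have := LinearMap.congr_fun hs.algRight.mul (h ⊗ₜ[k] (u ⊗ₜ[k] x))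
    simp only [LinearMap.comp_apply, LinearMap.lTensor_tmul, LinearMap.mul'_apply, slideR,
      LinearEquiv.coe_coe, TensorProduct.assoc_symm_tmul, LinearMap.rTensor_tmul, hu,
      TensorProduct.assoc_tmul] at this
    rw [this]
    generalize s (h ⊗ₜ[k] x) = t
    induction t with
    | zero => simp
    | add x y hx hy => simp only [map_add, TensorProduct.tmul_add, smul_add, hx, hy]
    | tmul x y => simp [TensorProduct.smul_tmul']
  have hsγ' : ∀ h, s (h ⊗ₜ[k] γ' 1) = γ' 1 ⊗ₜ[k] h := by
    intro h
    have := hmul h _ (γ' 1) (hsγ h)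
    rw [h1, hs.algRight.unit] at this
    have := congrArg (γ' 1 • ·) this
    simpa [smul_smul, h2, TensorProduct.smul_tmul'] using this.symm
  -- The normalized map is `γ(1)⁻¹ γ`. Since `γ(1)⁻¹ = γ'(1)` is coinvariant and transparent to `s`,
  -- left multiplication by it preserves colinearity and the braiding.
  refine ⟨LinearMap.mulLeft k (γ' 1) ∘ₗ γ, LinearMap.mulRight k (γ 1) ∘ₗ γ',
    ⟨?_, ?_, ⟨?_, ?_⟩⟩, by simpa using h2⟩
  · ext h
    simp only [LinearMap.comp_apply, LinearMap.mulLeft_apply]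
    rw [← ha', hE.coaction_i_mul, hγ.coaction, smul_rTensor]
  · ext h l
    have := LinearMap.congr_fun hγ.braided (h ⊗ₜ[k] l)
    simp only [LinearMap.comp_apply, LinearMap.lTensor_tmul] at this
    simp only [TensorProduct.AlgebraTensorModule.curry_apply, TensorProduct.curry_apply,
      LinearMap.coe_restrictScalars, LinearMap.comp_apply, LinearMap.lTensor_tmul,
      LinearMap.mulLeft_apply]
    rw [hmul _ _ _ (hsγ' h), ← this, smul_rTensor]
  · ext h
    have := LinearMap.congr_fun hγ.inverse.mul_right h
    simp only [LinearMap.comp_apply] at this ⊢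
    have e : ∀ t : H ⊗[k] H, LinearMap.mul' k B (TensorProduct.map
        (LinearMap.mulLeft k (γ' 1) ∘ₗ γ) (LinearMap.mulRight k (γ 1) ∘ₗ γ') t) =
        γ' 1 * LinearMap.mul' k B (TensorProduct.map γ γ' t) * γ 1 := by
      intro t
      induction t with
      | zero => simp
      | add x y hx hy => simp only [map_add, mul_add, add_mul, hx, hy]
      | tmul x y => simp [mul_assoc]
    rw [e, this, Algebra.linearMap_apply, ← Algebra.commutes, mul_assoc, h2, mul_one]
  · ext h
    have := LinearMap.congr_fun hγ.inverse.mul_left h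
    simp only [LinearMap.comp_apply] at this ⊢
    rw [← this]
    generalize Coalgebra.comul (R := k) h = t
    induction t with
    | zero => simp
    | add x y hx hy => simp only [map_add, hx, hy]
    | tmul x y =>
      simp only [TensorProduct.map_tmul, LinearMap.comp_apply, LinearMap.mulRight_apply,
        LinearMap.mulLeft_apply, LinearMap.mul'_apply]
      rw [mul_assoc, ← mul_assoc (γ 1), h1, one_mul]

end Cleft

/-! ### The canonical map in terms of a normal basis -/

section Galois

variable {k : Type*} [Field k] {H : Type*} [Ring H] [Algebra k H] [Coalgebra k H]
  {A : Type*} [Ring A] [Algebra k A] {B : Type*} [Ring B] [Algebra k B]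
  {c : H ⊗[k] H →ₗ[k] H ⊗[k] H} {s : H ⊗[k] B →ₗ[k] B ⊗[k] H}
  {ν : B →ₗ[k] B ⊗[k] H} {i : A →ₐ[k] B} {γ : H →ₗ[k] B}

theorem mkQ_mul_tmul (b b' : B) (a : A) :
    (balanced (k := k) i).mkQ ((b * i a) ⊗ₜ[k] b') =
      (balanced (k := k) i).mkQ (b ⊗ₜ[k] (i a * b')) := by
  rw [← sub_eq_zero, ← map_sub, Submodule.mkQ_apply, Submodule.Quotient.mk_eq_zero]
  exact Submodule.subset_span ⟨b, b', a, rfl⟩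

/-- `B ⊗ H → B ⊗_A B`, `b ⊗ h ↦ b ⊗ γ(h)`. -/
def tensorBasis (i : A →ₐ[k] B) (γ : H →ₗ[k] B) : B ⊗[k] H →ₗ[k] TensorOver (k := k) i :=
  (balanced i).mkQ ∘ₗ γ.lTensor B

/-- `B ⊗_A B ≅ B ⊗_A (A ⊗ H) ≅ B ⊗ H`; the inverse is `b ⊗ φ(a ⊗ h) ↦ b i(a) ⊗ h`. -/
theorem tensorBasis_bijective {φ : A ⊗[k] H ≃ₗ[k] B}
    (hφ : ∀ (a : A) (h : H), φ (a ⊗ₜ[k] h) = i a * γ h) :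
    Function.Bijective (tensorBasis i γ) := by
  let q : B ⊗[k] (A ⊗[k] H) →ₗ[k] B ⊗[k] H :=
    (LinearMap.mul' k B ∘ₗ i.toLinearMap.lTensor B).rTensor H ∘ₗ
      (TensorProduct.assoc k B A H).symm.toLinearMap
  have hφl : ∀ (a : A) (t : A ⊗[k] H), φ (a • t) = i a * φ t := by
    intro a t
    induction t with
    | zero => simp
    | add x y hx hy => simp only [smul_add, map_add, mul_add, hx, hy]
    | tmul x h => simp [TensorProduct.smul_tmul', hφ, mul_assoc]
  have hq : balanced i ≤ LinearMap.ker (q ∘ₗ φ.symm.toLinearMap.lTensor B) := by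
    refine Submodule.span_le.2 ?_
    rintro _ ⟨b, b', a, rfl⟩
    obtain ⟨t, rfl⟩ := φ.surjective b'
    rw [SetLike.mem_coe, LinearMap.mem_ker, map_sub, sub_eq_zero, ← hφl]
    simp only [LinearMap.comp_apply, LinearMap.lTensor_tmul, LinearEquiv.coe_coe,
      LinearEquiv.symm_apply_apply]
    induction t with
    | zero => simp
    | add x y hx hy => simp only [smul_add, map_add, TensorProduct.tmul_add, hx, hy]
    | tmul x h => simp [q, TensorProduct.smul_tmul', mul_assoc]
  refine Function.bijective_iff_has_inverse.2 ⟨(balanced i).liftQ _ hq, fun t => ?_, fun t => ?_⟩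
  · induction t with
    | zero => simp
    | add x y hx hy => simp only [map_add, hx, hy]
    | tmul b h =>
      have : φ.symm (γ h) = 1 ⊗ₜ[k] h := by
        rw [LinearEquiv.symm_apply_eq, hφ, map_one, one_mul]
      simp [tensorBasis, this, q]
  · obtain ⟨t, rfl⟩ := (balanced i).mkQ_surjective t
    induction t with
    | zero => simp
    | add x y hx hy => simp only [map_add, hx, hy]
    | tmul b b' =>
      obtain ⟨t, rfl⟩ := φ.surjective b'
      simp only [Submodule.mkQ_apply, Submodule.liftQ_apply, LinearMap.comp_apply,
        LinearMap.lTensor_tmul, LinearEquiv.coe_coe, LinearEquiv.symm_apply_apply]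
      simp only [← Submodule.mkQ_apply]
      induction t with
      | zero => simp
      | add x y hx hy => simp only [map_add, TensorProduct.tmul_add, hx, hy]
      | tmul a h =>
        rw [hφ, ← mkQ_mul_tmul]
        simp [q, tensorBasis]

/-- Colinearity of `γ` turns `(b ⊗ 1) ν(γ(h))` into `b γ(h₁) ⊗ h₂`. Thus the Galois condition
concerns `γ` alone. -/
theorem galoisMap_comp_tensorBasis (hE : IsExtension c s ν i)
    (hγ : ν ∘ₗ γ = γ.rTensor H ∘ₗ Coalgebra.comul) (t : B ⊗[k] H) :
    galoisMap hE (tensorBasis i γ t) = spread Coalgebra.comul γ t := by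
  induction t with
  | zero => simp
  | add x y hx hy => simp only [map_add, hx, hy]
  | tmul b h =>
    have := LinearMap.congr_fun hγ h
    simp only [LinearMap.comp_apply] at this
    simp [galoisMap, tensorBasis, galoisMap₀, twistedMul_one_left hE.comoduleAlgebra, this,
      spread_tmul]

theorem isGalois_iff_spread_bijective (hE : IsExtension c s ν i)
    (hγ : ν ∘ₗ γ = γ.rTensor H ∘ₗ Coalgebra.comul) {φ : A ⊗[k] H ≃ₗ[k] B}
    (hφ : ∀ (a : A) (h : H), φ (a ⊗ₜ[k] h) = i a * γ h) :
    IsGalois hE ↔ Function.Bijective (spread (R := B) Coalgebra.comul γ) := by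
  have : ⇑(spread (R := B) Coalgebra.comul γ) = galoisMap hE ∘ tensorBasis i γ :=
    funext fun t => (galoisMap_comp_tensorBasis hE hγ t).symm
  rw [this, IsGalois]
  exact (Function.Bijective.of_comp_iff _ (tensorBasis_bijective hφ)).symm

end Galois

/-! ### The section of a normal basis, and invertibility of `γ` versus `σ` -/

section NormalBasis

variable {k : Type*} [Field k] {H : Type*} [Ring H] [Algebra k H] [Coalgebra k H]
  {A : Type*} [Ring A] [Algebra k A] {B : Type*} [Ring B] [Algebra k B]
  {c : H ⊗[k] H →ₗ[k] H ⊗[k] H} {s : H ⊗[k] B →ₗ[k] B ⊗[k] H}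
  {ν : B →ₗ[k] B ⊗[k] H} {i : A →ₐ[k] B} {sA : H ⊗[k] A →ₗ[k] A ⊗[k] H}
  {φ : A ⊗[k] H ≃ₗ[k] B}

/-- `h ↦ φ(1 ⊗ h)`. -/
def basisSection (φ : A ⊗[k] H ≃ₗ[k] B) : H →ₗ[k] B :=
  φ.toLinearMap ∘ₗ TensorProduct.mk k A H 1

theorem basisSection_apply (h : H) : basisSection φ h = φ (1 ⊗ₜ[k] h) := rfl

theorem IsNormalBasis.apply_tmul (hφ : IsNormalBasis c s ν i sA φ) (a : A) (h : H) :
    φ (a ⊗ₜ[k] h) = i a * basisSection φ h := by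
  rw [basisSection_apply, ← hφ.linear, TensorProduct.smul_tmul', smul_eq_mul, mul_one]

theorem IsNormalBasis.section_colinear (hφ : IsNormalBasis c s ν i sA φ) :
    ν ∘ₗ basisSection φ = (basisSection φ).rTensor H ∘ₗ Coalgebra.comul := by
  ext h
  have := LinearMap.congr_fun hφ.colinear (1 ⊗ₜ[k] h)
  simp only [LinearMap.comp_apply, LinearEquiv.coe_coe, freeCoaction, LinearMap.lTensor_tmul]
    at this
  rw [LinearMap.comp_apply, LinearMap.comp_apply, basisSection_apply, this]
  generalize Coalgebra.comul (R := k) h = u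
  induction u with
  | zero => simp
  | add x y hx hy => simp only [map_add, TensorProduct.tmul_add, hx, hy]
  | tmul x y => simp [basisSection_apply]

/-- As `s_A` fixes the unit of `A`, on `1 ⊗ H` the transposition of `A ⊗ H` is just `c`. -/
theorem IsNormalBasis.section_braided (hφ : IsNormalBasis c s ν i sA φ)
    (hsA : ∀ h : H, sA (h ⊗ₜ[k] 1) = 1 ⊗ₜ[k] h) :
    (basisSection φ).rTensor H ∘ₗ c = s ∘ₗ (basisSection φ).lTensor H := by
  ext h l
  have := LinearMap.congr_fun hφ.braided (h ⊗ₜ[k] (1 ⊗ₜ[k] l))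
  simp only [LinearMap.comp_apply, LinearEquiv.coe_coe, hatTransposition, slideR,
    LinearMap.lTensor_tmul, TensorProduct.assoc_symm_tmul, LinearMap.rTensor_tmul, hsA,
    TensorProduct.assoc_tmul] at this
  simp only [TensorProduct.AlgebraTensorModule.curry_apply, TensorProduct.curry_apply,
    LinearMap.coe_restrictScalars, LinearMap.comp_apply, LinearMap.lTensor_tmul,
    basisSection_apply]
  rw [← this]
  generalize c (h ⊗ₜ[k] l) = u
  induction u with
  | zero => simp
  | add x y hx hy => simp only [map_add, TensorProduct.tmul_add, hx, hy]
  | tmul x y => simp [basisSection_apply]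

/-- An extension with a normal basis whose section is convolution invertible is cleft. -/
theorem IsNormalBasis.isCleft_of_bijective (hφ : IsNormalBasis c s ν i sA φ)
    (hsA : ∀ h : H, sA (h ⊗ₜ[k] 1) = 1 ⊗ₜ[k] h)
    (hb : Function.Bijective (spread (R := B) Coalgebra.comul (basisSection φ))) :
    IsCleft c s ν :=
  have ⟨γ', hγ'⟩ := exists_isConvInverse_of_bijective (isCoalg_comul H) hb
  ⟨basisSection φ, γ', hφ.section_colinear, hφ.section_braided hsA, hγ'⟩

/-- `(h₁ ⊗ l₁) ⊗ h₂l₂ ⊗ l₃`, with the comultiplication of `H ⊗^c H` understood. -/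
theorem lTensor_spread_comul₂ (h l : H) :
    (TensorProduct.assoc k (H ⊗[k] H) H H).symm ((spread Coalgebra.comul
      (LinearMap.id : H →ₗ[k] H)).lTensor (H ⊗[k] H) (comul₂ c (h ⊗ₜ[k] l))) =
    ((LinearMap.mul' k H).lTensor (H ⊗[k] H) ∘ₗ comul₂ c).rTensor H
      ((TensorProduct.assoc k H H H).symm (h ⊗ₜ[k] Coalgebra.comul (R := k) l)) := by
  -- The crossing does not touch the second leg of `Δ(l)`, so that leg can be split before `c` is
  -- applied; coassociativity on `l` then identifies the two sides.
  have e1 : ∀ t v : H ⊗[k] H, (TensorProduct.assoc k (H ⊗[k] H) H H).symm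
      ((spread Coalgebra.comul (LinearMap.id : H →ₗ[k] H)).lTensor (H ⊗[k] H)
        (mid H H c (t ⊗ₜ[k] v))) =
      ((LinearMap.mul' k H).lTensor (H ⊗[k] H) ∘ₗ mid H H c ∘ₗ
        TensorProduct.mk k (H ⊗[k] H) (H ⊗[k] H) t).rTensor H
          ((TensorProduct.assoc k H H H).symm (Coalgebra.comul.lTensor H v)) := by
    intro t v
    induction v with
    | zero => simp
    | add x y hx hy => simp only [map_add, TensorProduct.tmul_add, hx, hy]
    | tmul z w =>
      induction t with
      | zero => simp
      | add x y hx hy =>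
        simp only [map_add, TensorProduct.add_tmul, hx, hy, LinearMap.comp_add,
          LinearMap.rTensor_add, LinearMap.add_apply]
      | tmul x y =>
        simp only [mid, LinearMap.comp_apply, LinearEquiv.coe_coe, TensorProduct.assoc_tmul,
          LinearMap.lTensor_tmul, TensorProduct.assoc_symm_tmul, LinearMap.rTensor_tmul]
        have e2 : ∀ q : H ⊗[k] H, (TensorProduct.assoc k (H ⊗[k] H) H H).symm
            ((spread Coalgebra.comul (LinearMap.id : H →ₗ[k] H)).lTensor (H ⊗[k] H)
              ((TensorProduct.assoc k H H (H ⊗[k] H)).symm (x ⊗ₜ[k]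
                TensorProduct.assoc k H H H (q ⊗ₜ[k] w)))) =
            ((LinearMap.mul' k H).lTensor (H ⊗[k] H) ∘ₗ
              (TensorProduct.assoc k H H (H ⊗[k] H)).symm.toLinearMap ∘ₗ
              TensorProduct.mk k H (H ⊗[k] (H ⊗[k] H)) x ∘ₗ
              (TensorProduct.assoc k H H H).toLinearMap ∘ₗ
              TensorProduct.mk k (H ⊗[k] H) H q).rTensor H (Coalgebra.comul (R := k) w) := by
          intro q
          induction q with
          | zero => simp
          | add x y hx hy =>
            simp only [map_add, TensorProduct.add_tmul, TensorProduct.tmul_add, hx, hy,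
              LinearMap.comp_add, LinearMap.rTensor_add, LinearMap.add_apply]
          | tmul p q =>
            simp only [TensorProduct.assoc_tmul, TensorProduct.assoc_symm_tmul,
              LinearMap.lTensor_tmul, spread_tmul, LinearMap.rTensor_id, LinearMap.id_apply]
            generalize Coalgebra.comul (R := k) w = u
            induction u with
            | zero => simp
            | add x y hx hy => simp only [map_add, smul_add, TensorProduct.tmul_add, hx, hy]
            | tmul a b => simp [TensorProduct.smul_tmul']
        rw [e2]
        generalize Coalgebra.comul (R := k) w = u
        induction u with
        | zero => simp
        | add x y hx hy => simp only [map_add, TensorProduct.tmul_add, hx, hy]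
        | tmul a b => simp
  have e3 : ∀ v : H ⊗[k] H, ((LinearMap.mul' k H).lTensor (H ⊗[k] H) ∘ₗ comul₂ c).rTensor H
      ((TensorProduct.assoc k H H H).symm (h ⊗ₜ[k] v)) =
      ((LinearMap.mul' k H).lTensor (H ⊗[k] H) ∘ₗ mid H H c ∘ₗ
        TensorProduct.mk k (H ⊗[k] H) (H ⊗[k] H) (Coalgebra.comul (R := k) h)).rTensor H
          (Coalgebra.comul.rTensor H v) := by
    intro v
    induction v with
    | zero => simp
    | add x y hx hy => simp only [map_add, TensorProduct.tmul_add, hx, hy]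
    | tmul x y => simp [comul₂, twistedComul]
  rw [e3, comul₂, twistedComul, LinearMap.comp_apply, TensorProduct.map_tmul, e1,
    ← Coalgebra.coassoc_apply, LinearEquiv.symm_apply_apply]

/-- If the products of values of `γ` are given by `σ`, then `γ` is convolution invertible if and
only if `σ` is. -/
theorem spread_bijective_iff (hH : IsBraidedHopfAlgebra c) {γ : H →ₗ[k] B}
    (hφ : ∀ (a : A) (h : H), φ (a ⊗ₜ[k] h) = i a * γ h) {σ : H ⊗[k] H →ₗ[k] A}
    (hσ : ∀ h l, γ h * γ l = φ (crossedF c σ (h ⊗ₜ[k] l))) :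
    Function.Bijective (spread (R := B) Coalgebra.comul γ) ↔
      Function.Bijective (spread (R := A) (comul₂ c) σ) := by
  obtain ⟨S, hS⟩ := hH.exists_antipode
  -- The only place where the antipode enters: `h ⊗ l ↦ h l₁ ⊗ l₂` is bijective.
  have hid : Function.Bijective (spread (R := H) (k := k) Coalgebra.comul LinearMap.id) :=
    spread_bijective (isCoalg_comul H) hS
  let e : H ⊗[k] H ≃ₗ[k] H ⊗[k] H := LinearEquiv.ofBijective _ hid
  let p : A ⊗[k] (H ⊗[k] H) ≃ₗ[k] B ⊗[k] H :=
    (TensorProduct.assoc k A H H).symm ≪≫ₗ LinearEquiv.rTensor H φ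
  -- At `a ⊗ h ⊗ l` the left side is `i(a) γ(h) γ(l₁) ⊗ l₂`. Expanding `γ(h) γ(l₁)` by `hσ` gives
  -- `φ(a σ(h₁ ⊗ l₁) ⊗ h₂ l₂) ⊗ l₃`.
  have key : ∀ t, spread Coalgebra.comul γ (p t) =
      p (LinearEquiv.lTensor A e (spread (comul₂ c) σ t)) := by
    intro t
    induction t with
    | zero => simp
    | add x y hx hy => simp only [map_add, hx, hy]
    | tmul a x =>
      induction x with
      | zero => simp
      | add x y hx hy => simp only [map_add, TensorProduct.tmul_add, hx, hy]
      | tmul h l =>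
        let Q : A ⊗[k] H →ₗ[k] B := LinearMap.mulLeft k (i a) ∘ₗ φ.toLinearMap
        have hQ : ∀ t, φ (a • t) = Q t := by
          intro t
          induction t with
          | zero => simp
          | add x y hx hy => simp only [smul_add, map_add, hx, hy]
          | tmul x h => simp [Q, TensorProduct.smul_tmul', hφ, mul_assoc]
        have e1 : ∀ w : (H ⊗[k] H) ⊗[k] (H ⊗[k] H),
            p (LinearEquiv.lTensor A e (a • σ.rTensor (H ⊗[k] H) w)) =
            (Q ∘ₗ σ.rTensor H).rTensor H ((TensorProduct.assoc k (H ⊗[k] H) H H).symm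
              ((spread Coalgebra.comul (LinearMap.id : H →ₗ[k] H)).lTensor (H ⊗[k] H) w)) := by
          intro w
          induction w with
          | zero => simp
          | add x y hx hy => simp only [map_add, smul_add, hx, hy]
          | tmul x y =>
            have : e y = spread Coalgebra.comul (LinearMap.id : H →ₗ[k] H) y := rfl
            simp only [LinearMap.rTensor_tmul, TensorProduct.smul_tmul',
              LinearEquiv.lTensor_tmul, LinearMap.lTensor_tmul, this]
            generalize spread Coalgebra.comul (LinearMap.id : H →ₗ[k] H) y = u
            induction u with
            | zero => simp
            | add x y hx hy => simp only [map_add, TensorProduct.tmul_add, hx, hy]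
            | tmul y z => simp [p, ← hQ, TensorProduct.smul_tmul']
        rw [spread_tmul, e1, lTensor_spread_comul₂]
        have e2 : p (a ⊗ₜ[k] (h ⊗ₜ[k] l)) = (i a * γ h) ⊗ₜ[k] l := by simp [p, hφ]
        rw [e2, spread_tmul]
        generalize Coalgebra.comul (R := k) l = u
        induction u with
        | zero => simp
        | add x y hx hy => simp only [map_add, smul_add, TensorProduct.tmul_add, hx, hy]
        | tmul x y =>
          have e3 : σ.rTensor H ((LinearMap.mul' k H).lTensor (H ⊗[k] H)
              (comul₂ c (h ⊗ₜ[k] x))) = crossedF c σ (h ⊗ₜ[k] x) := by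
            rw [← LinearMap.comp_apply, LinearMap.rTensor_comp_lTensor]
            rfl
          simp [TensorProduct.smul_tmul', mul_assoc, hσ, e3, Q]
  have h1 : ⇑(spread (R := B) Coalgebra.comul γ) ∘ p =
    (p ∘ LinearEquiv.lTensor A e) ∘ spread (comul₂ c) σ := funext key
  rw [← Function.Bijective.of_comp_iff _ p.bijective, h1]
  exact Function.Bijective.of_comp_iff' (p.bijective.comp (LinearEquiv.lTensor A e).bijective) _

end NormalBasis

/-! ### Recovering the action and the cocycle from a crossed product -/

section Crossed

variable {k : Type*} [Field k] {H : Type*} [Ring H] [Algebra k H] [Coalgebra k H]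
  {A : Type*} [Ring A] [Algebra k A]
  {c : H ⊗[k] H →ₗ[k] H ⊗[k] H} {sA : H ⊗[k] A →ₗ[k] A ⊗[k] H}
  {ρ : H ⊗[k] A →ₗ[k] A} {σ : H ⊗[k] H →ₗ[k] A}

theorem idCounit_tmul (a : A) (h : H) :
    idCounit k A H (a ⊗ₜ[k] h) = Coalgebra.counit (R := k) h • a := by
  simp [idCounit]

theorem idCounit_smul (a : A) (t : A ⊗[k] H) :
    idCounit k A H (a • t) = a * idCounit k A H t := by
  induction t with
  | zero => simp
  | add x y hx hy => simp only [smul_add, map_add, mul_add, hx, hy]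
  | tmul x h => simp [TensorProduct.smul_tmul', idCounit_tmul]

/-- The counit axiom, in the form that shows a colinear map into `A ⊗ H` to be determined by its
composite with `A ⊗ ε`. -/
theorem idCounit_rTensor_freeCoaction (t : A ⊗[k] H) :
    (idCounit k A H).rTensor H (freeCoaction k A H t) = t := by
  induction t with
  | zero => simp
  | add x y hx hy => simp only [map_add, hx, hy]
  | tmul a h =>
    have : ∀ u : H ⊗[k] H, (idCounit k A H).rTensor H ((TensorProduct.assoc k A H H).symm
        (a ⊗ₜ[k] u)) = (TensorProduct.lid k H).toLinearMap.lTensor A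
          (a ⊗ₜ[k] Coalgebra.counit.rTensor H u) := by
      intro u
      induction u with
      | zero => simp
      | add x y hx hy => simp only [map_add, TensorProduct.tmul_add, hx, hy]
      | tmul x y => simp [idCounit_tmul, TensorProduct.smul_tmul]
    simp only [freeCoaction, LinearMap.comp_apply, LinearMap.lTensor_tmul, LinearEquiv.coe_coe]
    rw [this, Coalgebra.rTensor_counit_comul]
    simp

theorem idCounit_braided (hc : CoalgCompatRight c) :
    (idCounit k A H).rTensor H ∘ₗ hatTransposition c sA =
      sA ∘ₗ (idCounit k A H).lTensor H := by
  ext h a l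
  have h1 : ∀ t : A ⊗[k] H, (idCounit k A H).rTensor H ((TensorProduct.assoc k A H H).symm
      (c.lTensor A (TensorProduct.assoc k A H H (t ⊗ₜ[k] l)))) =
      Coalgebra.counit (R := k) l • t := by
    intro t
    induction t with
    | zero => simp
    | add x y hx hy => simp only [map_add, TensorProduct.add_tmul, smul_add, hx, hy]
    | tmul x y =>
      have h2 := LinearMap.congr_fun hc.counit (y ⊗ₜ[k] l)
      have h3 : ∀ u : H ⊗[k] H, (idCounit k A H).rTensor H ((TensorProduct.assoc k A H H).symm
          (x ⊗ₜ[k] u)) = x ⊗ₜ[k] TensorProduct.lid k H (Coalgebra.counit.rTensor H u) := by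
        intro u
        induction u with
        | zero => simp
        | add x y hx hy => simp only [map_add, TensorProduct.tmul_add, hx, hy]
        | tmul x y => simp [idCounit_tmul, TensorProduct.smul_tmul]
      simp only [LinearMap.comp_apply, LinearEquiv.coe_coe] at h2
      rw [TensorProduct.assoc_tmul, LinearMap.lTensor_tmul, h3, h2]
      simp [TensorProduct.tmul_smul]
  simp [hatTransposition, slideR, h1, idCounit_tmul, TensorProduct.tmul_smul]

/-- Separates the three stages of the product: move `h` past `b` by `χ`, merge with `l` by `ℱ`, and
act by coefficients in `A` on the left. -/
theorem crossedMul_tmul (a b : A) (h l : H) :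
    crossedMul c sA ρ σ ((a ⊗ₜ[k] h) ⊗ₜ[k] (b ⊗ₜ[k] l)) =
      a • actMap (crossedF c σ ∘ₗ (TensorProduct.mk k H H).flip l)
        (crossedχ sA ρ (h ⊗ₜ[k] b)) := by
  simp only [crossedMul, mid, LinearMap.comp_apply, LinearEquiv.coe_coe, TensorProduct.assoc_tmul,
    LinearMap.lTensor_tmul, TensorProduct.assoc_symm_tmul, LinearMap.rTensor_tmul]
  generalize crossedχ sA ρ (h ⊗ₜ[k] b) = t
  induction t with
  | zero => simp
  | add x y hx hy =>
    simp only [map_add, TensorProduct.add_tmul, TensorProduct.tmul_add, smul_add, hx, hy]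
  | tmul x y =>
    simp only [TensorProduct.assoc_tmul, TensorProduct.assoc_symm_tmul, TensorProduct.map_tmul,
      LinearMap.mul'_apply, actMap_tmul, LinearMap.comp_apply, LinearMap.flip_apply,
      TensorProduct.mk_apply]
    generalize crossedF c σ (y ⊗ₜ[k] l) = u
    induction u with
    | zero => simp
    | add x y hx hy => simp only [map_add, TensorProduct.tmul_add, smul_add, hx, hy]
    | tmul p q => simp [TensorProduct.smul_tmul', mul_assoc]

theorem crossedχ_one (hs : ∀ h : H, sA (h ⊗ₜ[k] 1) = 1 ⊗ₜ[k] h)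
    (hρ : ∀ h : H, ρ (h ⊗ₜ[k] 1) = algebraMap k A (Coalgebra.counit h)) (h : H) :
    crossedχ sA ρ (h ⊗ₜ[k] 1) = 1 ⊗ₜ[k] h := by
  have h1 : ∀ u : H ⊗[k] H, ρ.rTensor H ((TensorProduct.assoc k H A H).symm
      (sA.lTensor H (TensorProduct.assoc k H H A (u ⊗ₜ[k] 1)))) =
      (Algebra.linearMap k A ∘ₗ Coalgebra.counit).rTensor H u := by
    intro u
    induction u with
    | zero => simp
    | add x y hx hy => simp only [map_add, TensorProduct.add_tmul, hx, hy]
    | tmul x y => simp [hs, hρ]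
  simp only [crossedχ, LinearMap.comp_apply, LinearMap.rTensor_tmul, LinearEquiv.coe_coe]
  rw [h1, rTensor_unit_counit (isCoalg_comul H)]

/-- The counit kills the strand `h₂` after it has crossed `a`, because `s_A` is compatible with `ε`.
-/
theorem idCounit_crossedχ (hs : CoalgCompatLeft sA) (h : H) (a : A) :
    idCounit k A H (crossedχ sA ρ (h ⊗ₜ[k] a)) = ρ (h ⊗ₜ[k] a) := by
  have h1 : ∀ u : H ⊗[k] H, idCounit k A H (ρ.rTensor H ((TensorProduct.assoc k H A H).symm
      (sA.lTensor H (TensorProduct.assoc k H H A (u ⊗ₜ[k] a))))) =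
      ρ (TensorProduct.rid k H (Coalgebra.counit.lTensor H u) ⊗ₜ[k] a) := by
    intro u
    induction u with
    | zero => simp
    | add x y hx hy => simp only [map_add, TensorProduct.add_tmul, hx, hy]
    | tmul x y =>
      have h2 : ∀ t : A ⊗[k] H, idCounit k A H (ρ.rTensor H ((TensorProduct.assoc k H A H).symm
          (x ⊗ₜ[k] t))) = ρ (x ⊗ₜ[k] TensorProduct.rid k A (Coalgebra.counit.lTensor A t)) := by
        intro t
        induction t with
        | zero => simp
        | add x y hx hy => simp only [map_add, TensorProduct.tmul_add, hx, hy]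
        | tmul p q => simp [idCounit_tmul]
      have h3 := LinearMap.congr_fun hs.counit (y ⊗ₜ[k] a)
      simp only [LinearMap.comp_apply, LinearEquiv.coe_coe] at h3
      rw [TensorProduct.assoc_tmul, LinearMap.lTensor_tmul, h2, h3]
      simp [TensorProduct.smul_tmul]
  simp only [crossedχ, LinearMap.comp_apply, LinearMap.rTensor_tmul, LinearEquiv.coe_coe]
  rw [h1, Coalgebra.lTensor_counit_comul]
  simp

/-- Since `ε` is multiplicative, `ε(h₂ l₂)` is the counit of the second leg in `H ⊗^c H`. -/
theorem idCounit_crossedF (hH : IsBraidedBialgebra c) (x : H ⊗[k] H) :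
    idCounit k A H (crossedF c σ x) = σ x := by
  have h1 : ∀ u : (H ⊗[k] H) ⊗[k] (H ⊗[k] H),
      idCounit k A H (TensorProduct.map σ (LinearMap.mul' k H) u) =
      σ (TensorProduct.rid k _ ((counit₂ k H).lTensor _ u)) := by
    intro u
    induction u with
    | zero => simp
    | add x y hx hy => simp only [map_add, hx, hy]
    | tmul x y =>
      have : Coalgebra.counit (R := k) (LinearMap.mul' k H y) = counit₂ k H y := by
        induction y with
        | zero => simp
        | add x y hx hy => simp only [map_add, hx, hy]
        | tmul x y => simp [counit₂, hH.counit_mul]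
      simp [idCounit_tmul, this]
  rw [crossedF, LinearMap.comp_apply, h1,
    (isCoalg_comul₂ hH.coalgLeft hH.coalgRight).lTensor_counit]
  simp

/-- The product of `1 ⊗ h` and `1 ⊗ l` in a crossed product. -/
theorem IsCrossedSystem.crossedMul_one_one (hC : IsCrossedSystem c sA ρ σ) (h l : H) :
    crossedMul c sA ρ σ ((1 ⊗ₜ[k] h) ⊗ₜ[k] (1 ⊗ₜ[k] l)) = crossedF c σ (h ⊗ₜ[k] l) := by
  rw [crossedMul_tmul, crossedχ_one hC.transposition.algRight.unit hC.weakAction.act_one,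
    actMap_tmul, one_smul, one_smul]
  rfl

/-- Normality `σ(h ⊗ 1) = ε(h)1` removes the cocycle from this product, leaving `(A ⊗ ε) χ`. -/
theorem IsCrossedSystem.idCounit_crossedMul (hH : IsBraidedBialgebra c)
    (hC : IsCrossedSystem c sA ρ σ) (h : H) (a : A) :
    idCounit k A H (crossedMul c sA ρ σ ((1 ⊗ₜ[k] h) ⊗ₜ[k] (a ⊗ₜ[k] 1))) = ρ (h ⊗ₜ[k] a) := by
  rw [crossedMul_tmul, one_smul, ← idCounit_crossedχ hC.transposition.coalg h a]
  generalize crossedχ sA ρ (h ⊗ₜ[k] a) = t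
  induction t with
  | zero => simp
  | add x y hx hy => simp only [map_add, hx, hy]
  | tmul x y =>
    simp [actMap_tmul, idCounit_smul, idCounit_crossedF hH, hC.normal_right, idCounit_tmul,
      Algebra.algebraMap_eq_smul_one]

end Crossed

/-! ### From a crossed product isomorphism to cleftness and uniqueness -/

section CrossedIso

variable {k : Type*} [Field k] {H : Type*} [Ring H] [Algebra k H] [Coalgebra k H]
  {A : Type*} [Ring A] [Algebra k A] {B : Type*} [Ring B] [Algebra k B]
  {c : H ⊗[k] H →ₗ[k] H ⊗[k] H} {s : H ⊗[k] B →ₗ[k] B ⊗[k] H}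
  {ν : B →ₗ[k] B ⊗[k] H} {i : A →ₐ[k] B} {sA : H ⊗[k] A →ₗ[k] A ⊗[k] H}
  {ρ : H ⊗[k] A →ₗ[k] A} {σ : H ⊗[k] H →ₗ[k] A} {f : B ≃ₗ[k] A ⊗[k] H}

theorem IsCrossedProductIso.isNormalBasis (hf : IsCrossedProductIso c s ν i sA ρ σ f) :
    IsNormalBasis c s ν i sA f.symm where
  linear a x := by
    rw [LinearEquiv.symm_apply_eq, hf.linear, LinearEquiv.apply_symm_apply]
  colinear := by
    refine LinearMap.ext fun t => (LinearEquiv.rTensor H f).injective ?_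
    have := LinearMap.congr_fun hf.colinear (f.symm t)
    simp only [LinearMap.comp_apply, LinearEquiv.coe_coe, LinearEquiv.apply_symm_apply] at this
    exact this.symm.trans ((LinearEquiv.rTensor H f).apply_symm_apply _).symm
  braided := by
    refine LinearMap.ext fun t => (LinearEquiv.rTensor H f).injective ?_
    have := LinearMap.congr_fun hf.braided ((LinearEquiv.lTensor H f).symm t)
    refine ((LinearEquiv.rTensor H f).apply_symm_apply _).trans (Eq.trans ?_ this.symm)
    exact congrArg (hatTransposition c sA) ((LinearEquiv.lTensor H f).apply_symm_apply t).symm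

theorem IsNormalBasis.symm_colinear {φ : A ⊗[k] H ≃ₗ[k] B} (hφ : IsNormalBasis c s ν i sA φ) :
    freeCoaction k A H ∘ₗ φ.symm.toLinearMap = φ.symm.toLinearMap.rTensor H ∘ₗ ν := by
  refine LinearMap.ext fun b => (LinearEquiv.rTensor H φ).injective ?_
  have := LinearMap.congr_fun hφ.colinear (φ.symm b)
  simp only [LinearMap.comp_apply, LinearEquiv.coe_coe, LinearEquiv.apply_symm_apply] at this
  exact this.symm.trans ((LinearEquiv.rTensor H φ).apply_symm_apply _).symm

theorem IsNormalBasis.symm_braided {φ : A ⊗[k] H ≃ₗ[k] B} (hφ : IsNormalBasis c s ν i sA φ) :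
    φ.symm.toLinearMap.rTensor H ∘ₗ s = hatTransposition c sA ∘ₗ φ.symm.toLinearMap.lTensor H := by
  refine LinearMap.ext fun t => (LinearEquiv.rTensor H φ).injective ?_
  have := LinearMap.congr_fun hφ.braided ((LinearEquiv.lTensor H φ).symm t)
  refine ((LinearEquiv.rTensor H φ).apply_symm_apply _).trans (Eq.trans ?_ this.symm)
  exact congrArg s ((LinearEquiv.lTensor H φ).apply_symm_apply t).symm

/-- The section `h ↦ f⁻¹(1 ⊗ h)` multiplies according to `ℱ`, so invertibility of `σ` passes to it.
-/
theorem IsCrossedProductIso.isCleft (hH : IsBraidedHopfAlgebra c)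
    (hC : IsCrossedSystem c sA ρ σ) {σ' : H ⊗[k] H →ₗ[k] A}
    (hσ : IsConvInverse (comul₂ c) (counit₂ k H) σ σ')
    (hf : IsCrossedProductIso c s ν i sA ρ σ f) : IsCleft c s ν := by
  refine hf.isNormalBasis.isCleft_of_bijective hC.transposition.algRight.unit
    ((spread_bijective_iff hH hf.isNormalBasis.apply_tmul (σ := σ) fun h l => ?_).2
      (spread_bijective (isCoalg_comul₂ hH.coalgLeft hH.coalgRight) hσ))
  rw [LinearEquiv.eq_symm_apply, hf.map_mul, basisSection_apply, basisSection_apply,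
    LinearEquiv.apply_symm_apply, LinearEquiv.apply_symm_apply, hC.crossedMul_one_one]

/-- A crossed product structure is determined by the isomorphism. -/
theorem IsCrossedProductIso.action_cocycle_eq (hH : IsBraidedBialgebra c)
    (hC : IsCrossedSystem c sA ρ σ) {φ : A ⊗[k] H ≃ₗ[k] B} {γ : H →ₗ[k] B}
    (hφ : ∀ (a : A) (h : H), φ (a ⊗ₜ[k] h) = i a * γ h) (h1 : γ 1 = 1)
    (hf : IsCrossedProductIso c s ν i sA ρ σ φ.symm) :
    (∀ h a, ρ (h ⊗ₜ[k] a) = idCounit k A H (φ.symm (γ h * i a))) ∧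
      ∀ h l, σ (h ⊗ₜ[k] l) = idCounit k A H (φ.symm (γ h * γ l)) := by
  have e1 : ∀ h, φ.symm (γ h) = 1 ⊗ₜ[k] h := fun h => by
    rw [LinearEquiv.symm_apply_eq, hφ, _root_.map_one, one_mul]
  have e2 : ∀ a, φ.symm (i a) = a ⊗ₜ[k] 1 := fun a => by
    rw [LinearEquiv.symm_apply_eq, hφ, h1, mul_one]
  refine ⟨fun h a => ?_, fun h l => ?_⟩
  · rw [hf.map_mul, e1, e2, hC.idCounit_crossedMul hH]
  · rw [hf.map_mul, e1, e1, hC.crossedMul_one_one, idCounit_crossedF hH]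

end CrossedIso

/-! ### Rearranging the twisted module condition -/

section TwistedModule

variable {k : Type*} [Field k] {H : Type*} [Ring H] [Algebra k H] [Coalgebra k H]
  {A : Type*} [Ring A] [Algebra k A]
  {c : H ⊗[k] H →ₗ[k] H ⊗[k] H} {sA : H ⊗[k] A →ₗ[k] A ⊗[k] H}
  {ρ : H ⊗[k] A →ₗ[k] A} {σ : H ⊗[k] H →ₗ[k] A}

/-- The strand `y` lies to the right of the crossing, so `a` may pass it before the crossing takes
place. -/
theorem mid_slideL_eq (x y : H) (a : A) (t : H ⊗[k] H) :
    (slideL sA sA).lTensor (H ⊗[k] H) (TensorProduct.assoc k (H ⊗[k] H) (H ⊗[k] H) A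
      (mid H H c (t ⊗ₜ[k] (x ⊗ₜ[k] y)) ⊗ₜ[k] a)) =
    ((TensorProduct.assoc k A H H).toLinearMap ∘ₗ sA.rTensor H ∘ₗ
      (TensorProduct.assoc k H A H).symm.toLinearMap).lTensor (H ⊗[k] H)
        (TensorProduct.assoc k (H ⊗[k] H) H (A ⊗[k] H) ((TensorProduct.assoc k H H H).symm
          (c.lTensor H (TensorProduct.assoc k H H H (t ⊗ₜ[k] x))) ⊗ₜ[k] sA (y ⊗ₜ[k] a))) := by
  induction t with
  | zero => simp only [TensorProduct.zero_tmul, map_zero]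
  | add x y hx hy => simp only [map_add, TensorProduct.add_tmul, hx, hy]
  | tmul z w =>
    simp only [mid, LinearMap.comp_apply, LinearEquiv.coe_coe, TensorProduct.assoc_tmul,
      LinearMap.lTensor_tmul, TensorProduct.assoc_symm_tmul, LinearMap.rTensor_tmul]
    generalize c (w ⊗ₜ[k] x) = v
    induction v with
    | zero => simp only [TensorProduct.zero_tmul, TensorProduct.tmul_zero, map_zero]
    | add x y hx hy =>
      simp only [map_add, TensorProduct.add_tmul, TensorProduct.tmul_add, hx, hy]
    | tmul p q => simp [slideL]

set_option maxHeartbeats 1000000 in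
/-- Both sides are `ρ(h₁ ⊗ ρ(l₁ ⊗ a')) σ(h₂' ⊗ l₂')`. -/
theorem twistedModule_eq
    (hρ : ∀ (y x : H) (a : A), sA (y ⊗ₜ[k] ρ (x ⊗ₜ[k] a)) = ρ.rTensor H
      ((TensorProduct.assoc k H A H).symm (sA.lTensor H
        (TensorProduct.assoc k H H A (c (y ⊗ₜ[k] x) ⊗ₜ[k] a))))) (h l : H) (a : A) :
    LinearMap.mul' k A (TensorProduct.map
      (ρ ∘ₗ ρ.lTensor H ∘ₗ (TensorProduct.assoc k H H A).toLinearMap) σ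
        ((TensorProduct.assoc k (H ⊗[k] H) A (H ⊗[k] H)).symm
          ((slideL sA sA).lTensor (H ⊗[k] H) (TensorProduct.assoc k (H ⊗[k] H) (H ⊗[k] H) A
            (comul₂ c (h ⊗ₜ[k] l) ⊗ₜ[k] a))))) =
    LinearMap.mul' k A (σ.lTensor A (TensorProduct.assoc k A H H
      ((crossedχ sA ρ).rTensor H ((TensorProduct.assoc k H A H).symm
        (h ⊗ₜ[k] crossedχ sA ρ (l ⊗ₜ[k] a)))))) := by
  have hl : crossedχ sA ρ (l ⊗ₜ[k] a) = ρ.rTensor H ((TensorProduct.assoc k H A H).symm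
      (sA.lTensor H (TensorProduct.assoc k H H A (Coalgebra.comul (R := k) l ⊗ₜ[k] a)))) := rfl
  rw [hl, comul₂, twistedComul, LinearMap.comp_apply, TensorProduct.map_tmul]
  generalize Coalgebra.comul (R := k) l = u
  induction u with
  | zero => simp only [TensorProduct.zero_tmul, TensorProduct.tmul_zero, map_zero]
  | add x y hx hy =>
    simp only [map_add, TensorProduct.add_tmul, TensorProduct.tmul_add, hx, hy]
  | tmul x y =>
    rw [mid_slideL_eq, TensorProduct.assoc_tmul, LinearMap.lTensor_tmul]
    generalize sA (y ⊗ₜ[k] a) = p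
    induction p with
    | zero => simp only [TensorProduct.tmul_zero, map_zero]
    | add x y hx hy => simp only [map_add, TensorProduct.tmul_add, hx, hy]
    | tmul a' y' =>
      have hχ : ∀ b, crossedχ sA ρ (h ⊗ₜ[k] b) = ρ.rTensor H ((TensorProduct.assoc k H A H).symm
          (sA.lTensor H (TensorProduct.assoc k H H A
            (Coalgebra.comul (R := k) h ⊗ₜ[k] b)))) := fun _ => rfl
      rw [TensorProduct.assoc_symm_tmul, LinearMap.rTensor_tmul, TensorProduct.assoc_symm_tmul,
        LinearMap.rTensor_tmul, hχ]
      generalize Coalgebra.comul (R := k) h = t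
      induction t with
      | zero => simp only [TensorProduct.zero_tmul, map_zero]
      | add x y hx hy => simp only [map_add, TensorProduct.add_tmul, hx, hy]
      | tmul z w =>
        -- The braiding axiom `hρ` lets `w` pass `ρ(x ⊗ a')` by first crossing `x` and then `a'`,
        -- which produces the `c` of the other side.
        rw [TensorProduct.assoc_tmul, LinearMap.lTensor_tmul, TensorProduct.assoc_tmul,
          LinearMap.lTensor_tmul, hρ]
        generalize c (w ⊗ₜ[k] x) = v
        induction v with
        | zero => simp only [TensorProduct.zero_tmul, TensorProduct.tmul_zero, map_zero]
        | add x y hx hy =>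
          simp only [map_add, TensorProduct.add_tmul, TensorProduct.tmul_add, hx, hy]
        | tmul x' w' =>
          simp only [TensorProduct.assoc_symm_tmul, LinearMap.rTensor_tmul,
            LinearMap.comp_apply, TensorProduct.assoc_tmul, LinearMap.lTensor_tmul,
            LinearEquiv.coe_coe]
          generalize sA (w' ⊗ₜ[k] a') = q
          induction q with
          | zero => simp only [TensorProduct.zero_tmul, TensorProduct.tmul_zero, map_zero]
          | add x y hx hy =>
            simp only [map_add, TensorProduct.add_tmul, TensorProduct.tmul_add, hx, hy]
          | tmul a'' w'' =>
            simp only [TensorProduct.assoc_symm_tmul, TensorProduct.assoc_tmul,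
              TensorProduct.map_tmul, LinearMap.mul'_apply, LinearMap.comp_apply,
              LinearEquiv.coe_coe, LinearMap.lTensor_tmul, LinearMap.rTensor_tmul]

end TwistedModule

/-! ### The crossed product attached to a normalized cleft map -/

section CleftCrossed

variable {k : Type*} [Field k] {H : Type*} [Ring H] [Algebra k H] [Coalgebra k H]
  {A : Type*} [Ring A] [Algebra k A] {B : Type*} [Ring B] [Algebra k B]
  {c : H ⊗[k] H →ₗ[k] H ⊗[k] H} {s : H ⊗[k] B →ₗ[k] B ⊗[k] H}
  {ν : B →ₗ[k] B ⊗[k] H} {i : A →ₐ[k] B} {sA : H ⊗[k] A →ₗ[k] A ⊗[k] H}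
  {φ : A ⊗[k] H ≃ₗ[k] B} {γ γ' : H →ₗ[k] B}

/-- `(A ⊗ ε) ∘ φ⁻¹`. -/
def basisCounit (φ : A ⊗[k] H ≃ₗ[k] B) : B →ₗ[k] A := idCounit k A H ∘ₗ φ.symm.toLinearMap

theorem basisCounit_apply (b : B) : basisCounit φ b = idCounit k A H (φ.symm b) := rfl

/-- `ρ(h ⊗ a) = (A ⊗ ε) φ⁻¹(γ(h) i(a))`. -/
def cleftAction (i : A →ₐ[k] B) (γ : H →ₗ[k] B) (φ : A ⊗[k] H ≃ₗ[k] B) : H ⊗[k] A →ₗ[k] A :=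
  basisCounit φ ∘ₗ LinearMap.mul' k B ∘ₗ TensorProduct.map γ i.toLinearMap

theorem cleftAction_tmul (h : H) (a : A) :
    cleftAction i γ φ (h ⊗ₜ[k] a) = basisCounit φ (γ h * i a) := rfl

/-- `σ(h ⊗ l) = (A ⊗ ε) φ⁻¹(γ(h) γ(l))`. -/
def cleftCocycle (γ : H →ₗ[k] B) (φ : A ⊗[k] H ≃ₗ[k] B) : H ⊗[k] H →ₗ[k] A :=
  basisCounit φ ∘ₗ LinearMap.mul' k B ∘ₗ TensorProduct.map γ γ

theorem cleftCocycle_tmul (h l : H) :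
    cleftCocycle γ φ (h ⊗ₜ[k] l) = basisCounit φ (γ h * γ l) := rfl

theorem basisCounit_i_mul (hφ : IsNormalBasis c s ν i sA φ) (a : A) (b : B) :
    basisCounit φ (i a * b) = a * basisCounit φ b := by
  obtain ⟨t, rfl⟩ := φ.surjective b
  rw [← hφ.linear, basisCounit_apply, basisCounit_apply, LinearEquiv.symm_apply_apply,
    LinearEquiv.symm_apply_apply, idCounit_smul]

/-- A colinear map into a free comodule is recovered from its composite with `A ⊗ ε`. Computing
`φ⁻¹` on a product thus reduces to computing `ν` on it. -/
theorem symm_eq_basisCounit (hφ : IsNormalBasis c s ν i sA φ) (b : B) :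
    φ.symm b = (basisCounit φ).rTensor H (ν b) := by
  have := LinearMap.congr_fun hφ.symm_colinear b
  simp only [LinearMap.comp_apply, LinearEquiv.coe_coe] at this
  rw [basisCounit, LinearMap.rTensor_comp_apply, ← this, idCounit_rTensor_freeCoaction]

/-- The source of both the braiding axiom for `ρ` and the compatibility of `σ` with `s_A`. -/
theorem basisCounit_braided (hc : CoalgCompatRight c) (hφ : IsNormalBasis c s ν i sA φ) :
    (basisCounit φ).rTensor H ∘ₗ s = sA ∘ₗ (basisCounit φ).lTensor H := by
  rw [basisCounit, LinearMap.rTensor_comp, LinearMap.comp_assoc, hφ.symm_braided,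
    LinearMap.lTensor_comp, ← LinearMap.comp_assoc, idCounit_braided hc, LinearMap.comp_assoc]

/-- `ν(γ(h) i(a)) = γ(h₁) i(a') ⊗ h₂'`, where `a' ⊗ h₂' = s_A(h₂ ⊗ a)`. -/
theorem coaction_γ_mul_i (hE : IsExtension c s ν i)
    (hsA : i.toLinearMap.rTensor H ∘ₗ sA = s ∘ₗ i.toLinearMap.lTensor H)
    (hγ : IsCleftMap c s ν γ γ') (h : H) (a : A) :
    ν (γ h * i a) = (LinearMap.mul' k B ∘ₗ TensorProduct.map γ i.toLinearMap).rTensor H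
      ((TensorProduct.assoc k H A H).symm (sA.lTensor H (TensorProduct.assoc k H H A
        (Coalgebra.comul (R := k) h ⊗ₜ[k] a)))) := by
  rw [hE.coaction_mul, hE.coaction_i, hγ.coaction]
  generalize Coalgebra.comul (R := k) h = t
  induction t with
  | zero => simp
  | add x y hx hy => simp only [map_add, TensorProduct.add_tmul, hx, hy]
  | tmul x y =>
    have := rTensor_tmul_right_eq hsA y a
    simp only [AlgHom.toLinearMap_apply] at this
    simp only [twistedMul, mid, LinearMap.comp_apply, LinearEquiv.coe_coe,
      TensorProduct.assoc_tmul, LinearMap.lTensor_tmul, TensorProduct.assoc_symm_tmul,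
      LinearMap.rTensor_tmul, this]
    generalize sA (y ⊗ₜ[k] a) = u
    induction u with
    | zero => simp
    | add x y hx hy => simp only [map_add, TensorProduct.add_tmul, TensorProduct.tmul_add, hx, hy]
    | tmul p q => simp

/-- `ν(γ(h) γ(l)) = γ(h₁) γ(l₁) ⊗ h₂ l₂`, with the comultiplication of `H ⊗^c H` understood. -/
theorem coaction_γ_mul_γ (hE : IsExtension c s ν i) (hγ : IsCleftMap c s ν γ γ') (h l : H) :
    ν (γ h * γ l) = TensorProduct.map (LinearMap.mul' k B ∘ₗ TensorProduct.map γ γ)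
      (LinearMap.mul' k H) (comul₂ c (h ⊗ₜ[k] l)) := by
  rw [hE.coaction_mul, hγ.coaction, hγ.coaction, comul₂, twistedComul, LinearMap.comp_apply,
    TensorProduct.map_tmul]
  generalize Coalgebra.comul (R := k) h = t
  generalize Coalgebra.comul (R := k) l = u
  induction t with
  | zero => simp
  | add x y hx hy => simp only [map_add, TensorProduct.add_tmul, hx, hy]
  | tmul x y =>
    induction u with
    | zero => simp
    | add x y hx hy => simp only [map_add, TensorProduct.tmul_add, hx, hy]
    | tmul z w =>
      simp only [twistedMul, mid, LinearMap.comp_apply, LinearEquiv.coe_coe,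
        TensorProduct.assoc_tmul, LinearMap.lTensor_tmul, TensorProduct.assoc_symm_tmul,
        LinearMap.rTensor_tmul, rTensor_tmul_right_eq hγ.braided]
      generalize c (y ⊗ₜ[k] z) = v
      induction v with
      | zero => simp
      | add x y hx hy =>
        simp only [map_add, TensorProduct.add_tmul, TensorProduct.tmul_add, hx, hy]
      | tmul p q => simp

/-- The commutation rule `γ(h) i(a) = φ(χ(h ⊗ a))`, which explains the shape of `χ`. -/
theorem symm_γ_mul_i (hE : IsExtension c s ν i)
    (hsA : i.toLinearMap.rTensor H ∘ₗ sA = s ∘ₗ i.toLinearMap.lTensor H)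
    (hγ : IsCleftMap c s ν γ γ') (hφ : IsNormalBasis c s ν i sA φ) (h : H) (a : A) :
    φ.symm (γ h * i a) = crossedχ sA (cleftAction i γ φ) (h ⊗ₜ[k] a) := by
  rw [symm_eq_basisCounit hφ, coaction_γ_mul_i hE hsA hγ, ← LinearMap.rTensor_comp_apply]
  rfl

/-- The multiplication rule `γ(h) γ(l) = φ(ℱ(h ⊗ l))`; it is also the hypothesis that
`spread_bijective_iff` requires. -/
theorem symm_γ_mul_γ (hE : IsExtension c s ν i) (hγ : IsCleftMap c s ν γ γ')
    (hφ : IsNormalBasis c s ν i sA φ) (h l : H) :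
    φ.symm (γ h * γ l) = crossedF c (cleftCocycle γ φ) (h ⊗ₜ[k] l) := by
  rw [symm_eq_basisCounit hφ, coaction_γ_mul_γ hE hγ, ← LinearMap.comp_apply,
    LinearMap.rTensor_comp_map]
  rfl

section Product

variable (hφ : ∀ (a : A) (h : H), φ (a ⊗ₜ[k] h) = i a * γ h)
  (hN : IsNormalBasis c s ν i sA φ)
include hφ hN

theorem basisCounit_mul_γ (t : A ⊗[k] H) (m : H) : basisCounit φ (φ t * γ m) =
    LinearMap.mul' k A ((cleftCocycle γ φ).lTensor A (TensorProduct.assoc k A H H (t ⊗ₜ[k] m))) := by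
  induction t with
  | zero => simp
  | add x y hx hy => simp only [map_add, add_mul, TensorProduct.add_tmul, hx, hy]
  | tmul a h => simp [hφ, mul_assoc, basisCounit_i_mul hN, cleftCocycle_tmul]

theorem basisCounit_mul_i (t : A ⊗[k] H) (a : A) : basisCounit φ (φ t * i a) =
    LinearMap.mul' k A ((cleftAction i γ φ).lTensor A
      (TensorProduct.assoc k A H A (t ⊗ₜ[k] a))) := by
  induction t with
  | zero => simp
  | add x y hx hy => simp only [map_add, add_mul, TensorProduct.add_tmul, hx, hy]
  | tmul b h => simp [hφ, mul_assoc, basisCounit_i_mul hN, cleftAction_tmul]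

theorem basisCounit_γ (h : H) :
    basisCounit φ (γ h) = algebraMap k A (Coalgebra.counit h) := by
  have : φ.symm (γ h) = 1 ⊗ₜ[k] h := by
    rw [LinearEquiv.symm_apply_eq, hφ, map_one, one_mul]
  rw [basisCounit_apply, this, idCounit_tmul, Algebra.algebraMap_eq_smul_one]

/-- `i((A ⊗ ε) φ⁻¹(b)) = b₀ γ'(b₁)`. -/
theorem i_basisCounit (hE : IsExtension c s ν i) (hγ : IsCleftMap c s ν γ γ') (b : B) :
    i (basisCounit φ b) = LinearMap.mul' k B (γ'.lTensor B (ν b)) := by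
  obtain ⟨t, rfl⟩ := φ.surjective b
  induction t with
  | zero => simp
  | add x y hx hy => simp only [map_add, hx, hy]
  | tmul a h =>
    have h1 : ∀ u : H ⊗[k] H, LinearMap.mul' k B (γ'.lTensor B (i a • γ.rTensor H u)) =
        i a * LinearMap.mul' k B (TensorProduct.map γ γ' u) := by
      intro u
      induction u with
      | zero => simp
      | add x y hx hy => simp only [map_add, smul_add, mul_add, hx, hy]
      | tmul x y => simp [TensorProduct.smul_tmul', mul_assoc]
    have h2 := LinearMap.congr_fun hγ.inverse.mul_right h
    simp only [LinearMap.comp_apply] at h2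
    rw [hφ, hE.coaction_i_mul, hγ.coaction, h1, h2, basisCounit_i_mul hN, basisCounit_γ hφ hN,
      map_mul]
    simp

theorem i_comp_cleftAction (hE : IsExtension c s ν i)
    (hsA : i.toLinearMap.rTensor H ∘ₗ sA = s ∘ₗ i.toLinearMap.lTensor H)
    (hγ : IsCleftMap c s ν γ γ') :
    i.toLinearMap ∘ₗ cleftAction i γ φ = actionFormula i sA γ γ' := by
  ext h a
  simp only [TensorProduct.AlgebraTensorModule.curry_apply, TensorProduct.curry_apply,
    LinearMap.coe_restrictScalars, LinearMap.comp_apply, cleftAction_tmul,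
    AlgHom.toLinearMap_apply, actionFormula, LinearMap.rTensor_tmul, LinearEquiv.coe_coe]
  rw [i_basisCounit hφ hN hE hγ, coaction_γ_mul_i hE hsA hγ, ← LinearMap.comp_apply (γ'.lTensor B),
    LinearMap.lTensor_comp_rTensor, ← LinearMap.comp_apply (LinearMap.rTensor B _),
    LinearMap.rTensor_comp_map]

theorem i_comp_cleftCocycle (hE : IsExtension c s ν i) (hγ : IsCleftMap c s ν γ γ') :
    i.toLinearMap ∘ₗ cleftCocycle γ φ = cocycleFormula c γ γ' := by
  ext h l
  simp only [TensorProduct.AlgebraTensorModule.curry_apply, TensorProduct.curry_apply,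
    LinearMap.coe_restrictScalars, LinearMap.comp_apply, cleftCocycle_tmul,
    AlgHom.toLinearMap_apply, cocycleFormula]
  rw [i_basisCounit hφ hN hE hγ, coaction_γ_mul_γ hE hγ, ← LinearMap.comp_apply (γ'.lTensor B),
    LinearMap.lTensor_comp_map, ← LinearMap.comp_apply (TensorProduct.map _ γ'),
    ← TensorProduct.map_comp]

/-- Multiplicativity is `γ(h) i(ab) = (γ(h) i(a)) i(b)` seen through `(A ⊗ ε) φ⁻¹`; the unit axioms
come from `γ(1) = 1` and `(A ⊗ ε) φ⁻¹ γ = ε`. -/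
theorem isWeakAction_cleftAction (hH : IsBraidedBialgebra c) (hE : IsExtension c s ν i)
    (hsA : i.toLinearMap.rTensor H ∘ₗ sA = s ∘ₗ i.toLinearMap.lTensor H)
    (hγ : IsCleftMap c s ν γ γ') (h1 : γ 1 = 1) : IsWeakAction c sA (cleftAction i γ φ) where
  one_act a := by
    have := basisCounit_i_mul hN a (γ 1)
    rw [basisCounit_γ hφ hN, hH.counit_one, map_one (algebraMap k A), mul_one, h1, mul_one] at this
    rw [cleftAction_tmul, h1, one_mul, this]
  braided := by
    have := mul_map_braided hE.comoduleAlgebra.transposition.algRight hγ.braided hsA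
    symm
    rw [cleftAction, LinearMap.rTensor_comp, LinearMap.comp_assoc, this, ← LinearMap.comp_assoc,
      basisCounit_braided hH.coalgRight hN, LinearMap.lTensor_comp _ (basisCounit φ),
      LinearMap.comp_assoc]
  act_one h := by
    rw [cleftAction_tmul, map_one, mul_one, basisCounit_γ hφ hN]
  act_mul := by
    ext h a b
    simp only [TensorProduct.AlgebraTensorModule.curry_apply, TensorProduct.curry_apply,
      LinearMap.coe_restrictScalars, LinearMap.comp_apply, LinearMap.lTensor_tmul,
      LinearMap.mul'_apply, LinearMap.rTensor_tmul]
    rw [cleftAction_tmul, map_mul i, ← mul_assoc, ← φ.apply_symm_apply (γ h * i a),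
      basisCounit_mul_i hφ hN, symm_γ_mul_i hE hsA hγ hN]
    simp only [crossedχ, LinearMap.comp_apply, LinearMap.rTensor_tmul, LinearEquiv.coe_coe]
    generalize Coalgebra.comul (R := k) h = t
    induction t with
    | zero => simp
    | add x y hx hy => simp only [map_add, TensorProduct.add_tmul, hx, hy]
    | tmul x y =>
      simp only [mid, LinearMap.comp_apply, LinearEquiv.coe_coe, TensorProduct.assoc_tmul,
        LinearMap.lTensor_tmul, TensorProduct.assoc_symm_tmul, LinearMap.rTensor_tmul]
      generalize sA (y ⊗ₜ[k] a) = u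
      induction u with
      | zero => simp
      | add x y hx hy =>
        simp only [map_add, TensorProduct.add_tmul, TensorProduct.tmul_add, hx, hy]
      | tmul p q => simp

theorem cleftCocycle_compatible (hH : IsBraidedBialgebra c) (hE : IsExtension c s ν i)
    (hγ : IsCleftMap c s ν γ γ') :
    (cleftCocycle γ φ).rTensor H ∘ₗ slideR c c = sA ∘ₗ (cleftCocycle γ φ).lTensor H := by
  have := mul_map_braided hE.comoduleAlgebra.transposition.algRight hγ.braided hγ.braided
  rw [cleftCocycle, LinearMap.rTensor_comp, LinearMap.comp_assoc, this, ← LinearMap.comp_assoc,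
    basisCounit_braided hH.coalgRight hN, LinearMap.lTensor_comp _ (basisCounit φ),
    LinearMap.comp_assoc]

/-- Evaluates the right-bracketed side of the associativity identities behind the two crossed
product conditions. -/
theorem basisCounit_γ_mul (hE : IsExtension c s ν i)
    (hsA : i.toLinearMap.rTensor H ∘ₗ sA = s ∘ₗ i.toLinearMap.lTensor H)
    (hγ : IsCleftMap c s ν γ γ') (h : H) (t : A ⊗[k] H) : basisCounit φ (γ h * φ t) =
    LinearMap.mul' k A ((cleftCocycle γ φ).lTensor A (TensorProduct.assoc k A H H
      ((crossedχ sA (cleftAction i γ φ)).rTensor H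
        ((TensorProduct.assoc k H A H).symm (h ⊗ₜ[k] t))))) := by
  induction t with
  | zero => simp
  | add x y hx hy => simp only [map_add, mul_add, TensorProduct.tmul_add, hx, hy]
  | tmul a l =>
    rw [hφ, ← mul_assoc, ← φ.apply_symm_apply (γ h * i a), basisCounit_mul_γ hφ hN,
      symm_γ_mul_i hE hsA hγ hN]
    simp

/-- This is `(A ⊗ ε) φ⁻¹` applied to `(γ(h) γ(l)) γ(m) = γ(h) (γ(l) γ(m))`. -/
theorem cocycleCondition_cleftCocycle (hH : IsBraidedBialgebra c) (hE : IsExtension c s ν i)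
    (hsA : i.toLinearMap.rTensor H ∘ₗ sA = s ∘ₗ i.toLinearMap.lTensor H)
    (hγ : IsCleftMap c s ν γ γ') :
    CocycleCondition c (cleftAction i γ φ) (cleftCocycle γ φ) := by
  have hcomp := cleftCocycle_compatible hφ hN hH hE hγ
  unfold CocycleCondition
  ext h l m
  have assoc := congrArg (basisCounit φ) (mul_assoc (γ h) (γ l) (γ m))
  rw [← φ.apply_symm_apply (γ h * γ l), basisCounit_mul_γ hφ hN, symm_γ_mul_γ hE hγ hN,
    ← φ.apply_symm_apply (γ l * γ m), basisCounit_γ_mul hφ hN hE hsA hγ, symm_γ_mul_γ hE hγ hN]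
    at assoc
  simp only [TensorProduct.AlgebraTensorModule.curry_apply, TensorProduct.curry_apply,
    LinearMap.coe_restrictScalars, LinearMap.comp_apply, LinearEquiv.coe_coe,
    TensorProduct.assoc_symm_tmul, LinearMap.rTensor_tmul]
  rw [assoc]
  simp only [twistedComul, LinearMap.comp_apply, TensorProduct.map_tmul, crossedF]
  generalize comul₂ c (l ⊗ₜ[k] m) = u
  induction u with
  | zero => simp
  | add x y hx hy => simp only [map_add, TensorProduct.tmul_add, hx, hy]
  | tmul x y =>
    simp only [TensorProduct.map_tmul, TensorProduct.assoc_symm_tmul, LinearMap.rTensor_tmul,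
      crossedχ, LinearMap.comp_apply]
    generalize Coalgebra.comul (R := k) h = t
    induction t with
    | zero => simp
    | add x y hx hy => simp only [map_add, TensorProduct.add_tmul, hx, hy]
    | tmul z w =>
      -- Associativity yields `s_A` applied to `w ⊗ σ(x)`, whereas the condition is stated with `w`
      -- crossing `x` by `c`; compatibility of `σ` with `s_A` equates the two.
      simp only [mid, LinearMap.comp_apply, LinearEquiv.coe_coe, TensorProduct.assoc_tmul,
        LinearMap.lTensor_tmul, TensorProduct.assoc_symm_tmul, LinearMap.rTensor_tmul,
        rTensor_tmul_right_eq hcomp]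
      generalize slideR c c (w ⊗ₜ[k] x) = v
      induction v with
      | zero => simp
      | add x y hx hy =>
        simp only [map_add, TensorProduct.add_tmul, TensorProduct.tmul_add, hx, hy]
      | tmul p q => simp

/-- This is `(A ⊗ ε) φ⁻¹` applied to `(γ(h) γ(l)) i(a) = γ(h) (γ(l) i(a))`. -/
theorem twistedModuleCondition_cleft (hH : IsBraidedBialgebra c) (hE : IsExtension c s ν i)
    (hsA : i.toLinearMap.rTensor H ∘ₗ sA = s ∘ₗ i.toLinearMap.lTensor H)
    (hγ : IsCleftMap c s ν γ γ') (h1 : γ 1 = 1) :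
    TwistedModuleCondition c sA (cleftAction i γ φ) (cleftCocycle γ φ) := by
  have hcomp := fun y x a => LinearMap.congr_fun
    (isWeakAction_cleftAction hφ hN hH hE hsA hγ h1).braided (y ⊗ₜ[k] (x ⊗ₜ[k] a))
  simp only [LinearMap.comp_apply, LinearMap.lTensor_tmul, slideR, LinearEquiv.coe_coe,
    TensorProduct.assoc_symm_tmul, LinearMap.rTensor_tmul] at hcomp
  unfold TwistedModuleCondition
  ext h l a
  have assoc := congrArg (basisCounit φ) (mul_assoc (γ h) (γ l) (i a))
  rw [← φ.apply_symm_apply (γ h * γ l), basisCounit_mul_i hφ hN, symm_γ_mul_γ hE hγ hN,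
    ← φ.apply_symm_apply (γ l * i a), basisCounit_γ_mul hφ hN hE hsA hγ,
    symm_γ_mul_i hE hsA hγ hN] at assoc
  simp only [TensorProduct.AlgebraTensorModule.curry_apply, TensorProduct.curry_apply,
    LinearMap.coe_restrictScalars, LinearMap.comp_apply, LinearEquiv.coe_coe,
    LinearMap.rTensor_tmul]
  rw [assoc]
  exact twistedModule_eq hcomp h l a

theorem isCrossedSystem_cleft (hH : IsBraidedBialgebra c) (hE : IsExtension c s ν i)
    (hsA : i.toLinearMap.rTensor H ∘ₗ sA = s ∘ₗ i.toLinearMap.lTensor H)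
    (ht : IsTransposition c sA) (hγ : IsCleftMap c s ν γ γ') (h1 : γ 1 = 1) :
    IsCrossedSystem c sA (cleftAction i γ φ) (cleftCocycle γ φ) where
  transposition := ht
  weakAction := isWeakAction_cleftAction hφ hN hH hE hsA hγ h1
  normal_left h := by rw [cleftCocycle_tmul, h1, one_mul, basisCounit_γ hφ hN]
  normal_right h := by rw [cleftCocycle_tmul, h1, mul_one, basisCounit_γ hφ hN]
  cocycle := cocycleCondition_cleftCocycle hφ hN hH hE hsA hγ
  twistedModule := twistedModuleCondition_cleft hφ hN hH hE hsA hγ h1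
  compatible := cleftCocycle_compatible hφ hN hH hE hγ

/-- In `i(a) γ(h) i(a') γ(l)`, first commute `γ(h)` past `i(a')`, then multiply the two values of
`γ`: these are the `χ` and `ℱ` stages of the crossed product. -/
theorem isCrossedProductIso_cleft (hE : IsExtension c s ν i)
    (hsA : i.toLinearMap.rTensor H ∘ₗ sA = s ∘ₗ i.toLinearMap.lTensor H)
    (hγ : IsCleftMap c s ν γ γ') (h1 : γ 1 = 1) :
    IsCrossedProductIso c s ν i sA (cleftAction i γ φ) (cleftCocycle γ φ) φ.symm where
  map_one := by rw [LinearEquiv.symm_apply_eq, hφ, h1, map_one, mul_one]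
  colinear := hN.symm_colinear
  braided := hN.symm_braided
  linear a b := by rw [LinearEquiv.symm_apply_eq, hN.linear, LinearEquiv.apply_symm_apply]
  map_mul b b' := by
    obtain ⟨t, rfl⟩ := φ.surjective b
    obtain ⟨t', rfl⟩ := φ.surjective b'
    simp only [LinearEquiv.symm_apply_apply]
    induction t with
    | zero => simp
    | add x y hx hy => simp only [map_add, add_mul, TensorProduct.add_tmul, hx, hy]
    | tmul a h =>
      induction t' with
      | zero => simp
      | add x y hx hy => simp only [map_add, mul_add, TensorProduct.tmul_add, hx, hy]
      | tmul a' l =>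
        rw [crossedMul_tmul, LinearEquiv.symm_apply_eq, hN.linear, hφ, hφ, mul_assoc,
          ← symm_γ_mul_i hE hsA hγ hN, ← mul_assoc (γ h), ← φ.apply_symm_apply (γ h * i a')]
        congr 1
        generalize φ.symm (γ h * i a') = u
        rw [LinearEquiv.symm_apply_apply]
        induction u with
        | zero => simp
        | add x y hx hy => simp only [map_add, add_mul, hx, hy]
        | tmul x y =>
          rw [actMap_tmul, hN.linear, hφ, mul_assoc, LinearMap.comp_apply, LinearMap.flip_apply,
            TensorProduct.mk_apply, ← symm_γ_mul_γ hE hγ hN, LinearEquiv.apply_symm_apply]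

end Product

end CleftCrossed

end BraidedHopf

end

/-! ### The main theorem -/

theorem mainTheorem1 {k : Type*} [Field k] {H : Type*} [Ring H] [Algebra k H] [Coalgebra k H]
    {A : Type*} [Ring A] [Algebra k A] {B : Type*} [Ring B] [Algebra k B]
    (c : H ⊗[k] H →ₗ[k] H ⊗[k] H) (hH : BraidedHopf.IsBraidedHopfAlgebra c)
    (s : H ⊗[k] B →ₗ[k] B ⊗[k] H) (ν : B →ₗ[k] B ⊗[k] H) (i : A →ₐ[k] B)
    (hE : BraidedHopf.IsExtension c s ν i) (sA : H ⊗[k] A →ₗ[k] A ⊗[k] H)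
    (hsA : sA = BraidedHopf.induced hH.toIsBraidedBialgebra hE) :
    List.TFAE [
      BraidedHopf.IsCleft c s ν,
      BraidedHopf.IsGalois hE ∧
        ∃ φ : A ⊗[k] H ≃ₗ[k] B, BraidedHopf.IsNormalBasis c s ν i sA φ,
      ∃ (ρ : H ⊗[k] A →ₗ[k] A) (σ : H ⊗[k] H →ₗ[k] A),
        BraidedHopf.IsCrossedSystem c sA ρ σ ∧
        (∃ σ' : H ⊗[k] H →ₗ[k] A, BraidedHopf.IsConvInverse (BraidedHopf.comul₂ c)
          (BraidedHopf.counit₂ k H) σ σ') ∧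
        ∃ f : B ≃ₗ[k] A ⊗[k] H, BraidedHopf.IsCrossedProductIso c s ν i sA ρ σ f] ∧
    ∀ γ γ' : H →ₗ[k] B, BraidedHopf.IsCleftMap c s ν γ γ' → γ 1 = 1 →
      ∃ φ : A ⊗[k] H ≃ₗ[k] B, (∀ (a : A) (h : H), φ (a ⊗ₜ[k] h) = i a * γ h) ∧
        BraidedHopf.IsNormalBasis c s ν i sA φ ∧
        ∃ (ρ : H ⊗[k] A →ₗ[k] A) (σ : H ⊗[k] H →ₗ[k] A),
          (∀ (h : H) (a : A),
            ρ (h ⊗ₜ[k] a) = BraidedHopf.idCounit k A H (φ.symm (γ h * i a))) ∧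
          (∀ h l : H, σ (h ⊗ₜ[k] l) = BraidedHopf.idCounit k A H (φ.symm (γ h * γ l))) ∧
          BraidedHopf.IsCrossedSystem c sA ρ σ ∧
          (∃ σ' : H ⊗[k] H →ₗ[k] A, BraidedHopf.IsConvInverse (BraidedHopf.comul₂ c)
            (BraidedHopf.counit₂ k H) σ σ') ∧
          BraidedHopf.IsCrossedProductIso c s ν i sA ρ σ φ.symm ∧
          (∀ (ρ₁ : H ⊗[k] A →ₗ[k] A) (σ₁ : H ⊗[k] H →ₗ[k] A),
            BraidedHopf.IsCrossedSystem c sA ρ₁ σ₁ →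
            BraidedHopf.IsCrossedProductIso c s ν i sA ρ₁ σ₁ φ.symm → ρ₁ = ρ ∧ σ₁ = σ) ∧
          i.toLinearMap ∘ₗ ρ = BraidedHopf.actionFormula i sA γ γ' ∧
          i.toLinearMap ∘ₗ σ = BraidedHopf.cocycleFormula c γ γ' := by
  subst hsA
  have hB := hH.toIsBraidedBialgebra
  have hC₂ := BraidedHopf.isCoalg_comul₂ (k := k) hB.coalgLeft hB.coalgRight
  have hspec := BraidedHopf.induced_spec hB hE
  have ht := BraidedHopf.induced_isTransposition hB hE
  have main : ∀ γ γ' : H →ₗ[k] B, BraidedHopf.IsCleftMap c s ν γ γ' → γ 1 = 1 →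
      ∀ φ : A ⊗[k] H ≃ₗ[k] B, (∀ (a : A) (h : H), φ (a ⊗ₜ[k] h) = i a * γ h) →
      BraidedHopf.IsNormalBasis c s ν i (BraidedHopf.induced hB hE) φ →
      ∃ σ' : H ⊗[k] H →ₗ[k] A, BraidedHopf.IsConvInverse (BraidedHopf.comul₂ c)
        (BraidedHopf.counit₂ k H) (BraidedHopf.cleftCocycle γ φ) σ' := fun γ γ' hγ h1 φ hφ hN =>
    BraidedHopf.exists_isConvInverse_of_bijective hC₂
      ((BraidedHopf.spread_bijective_iff hH hφ fun h l => by
        rw [← BraidedHopf.symm_γ_mul_γ hE hγ hN, LinearEquiv.apply_symm_apply]).1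
        (BraidedHopf.spread_bijective (BraidedHopf.isCoalg_comul H) hγ.inverse))
  refine ⟨?_, fun γ γ' hγ h1 => ?_⟩
  · tfae_have 1 → 2 := by
      rintro ⟨γ, γ', hγ⟩
      obtain ⟨φ, hφ, hN⟩ := hγ.exists_isNormalBasis hB hE
      exact ⟨(BraidedHopf.isGalois_iff_spread_bijective hE hγ.colinear hφ).2
        (BraidedHopf.spread_bijective (BraidedHopf.isCoalg_comul H) hγ.inverse), φ, hN⟩
    tfae_have 2 → 1 := by
      rintro ⟨hG, φ, hN⟩
      exact hN.isCleft_of_bijective ht.algRight.unit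
        ((BraidedHopf.isGalois_iff_spread_bijective hE hN.section_colinear hN.apply_tmul).1 hG)
    tfae_have 1 → 3 := by
      rintro ⟨γ₀, γ₀', hγ₀⟩
      -- Normality of `σ` and `ρ(1 ⊗ a) = a` require `γ(1) = 1`.
      obtain ⟨γ, γ', hγ, h1⟩ := hγ₀.exists_normalized hB hE
      obtain ⟨φ, hφ, hN⟩ := hγ.exists_isNormalBasis hB hE
      exact ⟨_, _, BraidedHopf.isCrossedSystem_cleft hφ hN hB hE hspec ht hγ h1,
        main γ γ' hγ h1 φ hφ hN, φ.symm,
        BraidedHopf.isCrossedProductIso_cleft hφ hN hE hspec hγ h1⟩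
    tfae_have 3 → 1 := by
      rintro ⟨ρ, σ, hC, ⟨σ', hσ⟩, f, hf⟩
      exact hf.isCleft hH hC hσ
    tfae_finish
  · obtain ⟨φ, hφ, hN⟩ := hγ.exists_isNormalBasis hB hE
    refine ⟨φ, hφ, hN, BraidedHopf.cleftAction i γ φ, BraidedHopf.cleftCocycle γ φ,
      fun _ _ => rfl, fun _ _ => rfl,
      BraidedHopf.isCrossedSystem_cleft hφ hN hB hE hspec ht hγ h1, main γ γ' hγ h1 φ hφ hN,
      BraidedHopf.isCrossedProductIso_cleft hφ hN hE hspec hγ h1, fun ρ₁ σ₁ hC hf => ?_,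
      BraidedHopf.i_comp_cleftAction hφ hN hE hspec hγ,
      BraidedHopf.i_comp_cleftCocycle hφ hN hE hγ⟩
    obtain ⟨e1, e2⟩ := hf.action_cocycle_eq hB hC hφ h1
    exact ⟨TensorProduct.ext' e1, TensorProduct.ext' e2⟩
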